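/- **Theorem 11.** Let $\lambda\in\mathbb{C}$ with $|\lambda|<\sqrt{2\pi}$, let $\mathbb{R}_+=(0,\infty)$ and $\sigma=\{s\in\mathbb{C}:\operatorname{Re}s=\tfrac12\}$. Functions are complex-valued and equations between $L_2$ functions are understood almost everywhere. For $G\in L_2(\sigma)$ its inverse Mellin transform is the function $$\frac{1}{2\pi i}\int_\sigma G(s)\,x^{-s}\,ds:=\lim_{N\to\infty}\frac{1}{2\pi}\int_{-N}^{N}G(\tfrac12+i\tau)\,x^{-1/2-i\tau}\,d\tau ,$$ the limit being taken in the norm of $L_2(\mathbb{R}_+)$. Consider the integro-functional equation $$\frac{2^{3/2}}{\sqrt{\pi}}\;PV\!\int_0^\infty\left[\frac1\pi\log\frac{x}{t}-1\right]\frac{t\,f(t)}{x^2-t^2}\,dt=\frac{\lambda}{x}\,f\!\left(\frac1x\right),\qquad x>0, \tag{A}$$ where $PV$ denotes the Cauchy principal value at $t=x$. (i) (Necessity) If $f\in L_2(\mathbb{R}_+)$ is a solution of (A), then there is a function $\varphi\in L_2(\sigma)$ with $\varphi(s)=\varphi(1-s)$, $s\in\sigma$, such that $$f(x)=\frac{1}{2\pi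 i}\int_\sigma\left[\sqrt{\frac{\pi}{2}}\;\frac{1+\sin(\pi s)}{\sin^2(\pi s/2)}+\lambda\right]^{-1}\varphi(s)\,x^{-s}\,ds,\qquad x>0, \tag{B}$$ the integral being convergent in the mean square sense. (ii) (Sufficiency) Let $\varphi\in L_2(\sigma)$ satisfy $\varphi(s)=\varphi(1-s)$, $s\in\sigma$, and let $\mu$ be its inverse Mellin transform. Then for every $x>0$ the integrals in $$(2\pi-\lambda^2)\,\mu(x)+4\int_0^\infty\frac{\mu(t)}{x+t}\,dt+\frac{2}{\pi}\int_0^\infty\frac{\log(x/t)\,\mu(t)}{x-t}\,dt=0,\qquad x\in\mathbb{R}_+, \tag{C}$$ converge absolutely; and if $\mu$ is a solution of (C), then the integral in (B) converges in the mean square sense and the function $f\in L_2(\mathbb{R}_+)$ defined by (B) is a solution of (A). -/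

import Mathlib

open MeasureTheory Set Filter Topology

noncomputable section

namespace HartleyFourier

/-- The half-line `ℝ₊ = (0, ∞)` with Lebesgue measure. -/
def halfLine : Measure ℝ := volume.restrict (Ioi (0 : ℝ))

/-- The parametrization `τ ↦ 1/2 + iτ` of the critical line `σ = {s : Re s = 1/2}`. -/
def line (τ : ℝ) : ℂ := 1 / 2 + (τ : ℂ) * Complex.I

/-- `φ ∈ L₂(σ)`; only the values of `φ` on the line `σ` matter. -/
def MemL2Line (φ : ℂ → ℂ) : Prop := MemLp (fun τ : ℝ => φ (line τ)) 2 volume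

/-- `(1 / 2πi) ∫ G(s) x^{-s} ds` over the segment of `σ` from `1/2 - iN` to `1/2 + iN`,
with `s = 1/2 + iτ`, `ds = i dτ`. -/
def truncInvMellin (G : ℂ → ℂ) (N x : ℝ) : ℂ :=
  (1 / (2 * (Real.pi : ℂ))) * ∫ τ in (-N)..N, G (line τ) * (x : ℂ) ^ (-line τ)

/-- `f ∈ L₂(ℝ₊)` is the inverse Mellin transform
`f(x) = (1 / 2πi) ∫_σ G(s) x^{-s} ds` of `G ∈ L₂(σ)`, the integral being convergent in the
mean square sense with respect to the norm of `L₂(ℝ₊)`. -/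
structure IsInvMellin (G : ℂ → ℂ) (f : ℝ → ℂ) : Prop where
  memL2Line : MemL2Line G
  memLp : MemLp f 2 halfLine
  tendsto : Tendsto (fun N : ℝ => eLpNorm (fun x => truncInvMellin G N x - f x) 2 halfLine)
    atTop (𝓝 0)

/-- `v = PV ∫_0^∞ g(t) dt` with the (only) singularity at `t = x`. -/
def HasPV (g : ℝ → ℂ) (x : ℝ) (v : ℂ) : Prop :=
  (∀ ε : ℝ, 0 < ε → IntegrableOn g {t : ℝ | 0 < t ∧ ε < |t - x|}) ∧
  Tendsto (fun ε : ℝ => ∫ t in {t : ℝ | 0 < t ∧ ε < |t - x|}, g t) (𝓝[>] 0) (𝓝 v)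

/-- The kernel `[(1/π) log(x/t) - 1] t / (x² - t²)`. -/
def kernel (x t : ℝ) : ℝ :=
  (1 / Real.pi * Real.log (x / t) - 1) * (t / (x ^ 2 - t ^ 2))

/-- The integro-functional equation
`(2^{3/2} / √π) PV ∫_0^∞ [(1/π) log(x/t) - 1] t f(t) / (x² - t²) dt = (λ/x) f(1/x)`
for almost every `x > 0`. -/
def SolvesIntegroFunctional (lam : ℂ) (f : ℝ → ℂ) : Prop :=
  ∀ᵐ x ∂halfLine, ∃ v : ℂ, HasPV (fun t : ℝ => (kernel x t : ℂ) * f t) x v ∧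
    (((2 : ℝ) ^ ((3 : ℝ) / 2) / Real.sqrt Real.pi : ℝ) : ℂ) * v =
      lam / (x : ℂ) * f (1 / x)

/-- `√(π/2) (1 + sin πs) / sin²(πs/2)`. -/
def symbol (s : ℂ) : ℂ :=
  ((Real.sqrt (Real.pi / 2) : ℝ) : ℂ) *
    ((1 + Complex.sin (Real.pi * s)) / Complex.sin (Real.pi * s / 2) ^ 2)

/-- Absolute convergence, at the point `x`, of `∫_0^∞ μ(t)/(x+t) dt` and
`∫_0^∞ log(x/t) μ(t)/(x-t) dt`. -/
def IntegralsConverge (μ : ℝ → ℂ) (x : ℝ) : Prop :=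
  IntegrableOn (fun t : ℝ => μ t / ((x + t : ℝ) : ℂ)) (Ioi 0) ∧
  IntegrableOn (fun t : ℝ => (Real.log (x / t) : ℂ) * μ t / ((x - t : ℝ) : ℂ)) (Ioi 0)

/-- The integral equation
`(2π - λ²) μ(x) + 4 ∫_0^∞ μ(t)/(x+t) dt + (2/π) ∫_0^∞ log(x/t) μ(t)/(x-t) dt = 0`
for almost every `x > 0`. -/
def SolvesIntegralEquation (lam : ℂ) (μ : ℝ → ℂ) : Prop :=
  ∀ᵐ x ∂halfLine,
    (2 * (Real.pi : ℂ) - lam ^ 2) * μ x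
      + 4 * (∫ t in Ioi (0 : ℝ), μ t / ((x + t : ℝ) : ℂ))
      + 2 / (Real.pi : ℂ) *
          (∫ t in Ioi (0 : ℝ), (Real.log (x / t) : ℂ) * μ t / ((x - t : ℝ) : ℂ)) = 0

end HartleyFourier

end

/-!
The unitary substitution `x = e^u` turns the Mellin transform on the critical line into the `L²`
Fourier transform on `ℝ`, and every kernel of the theorem into a convolution kernel. The kernels
`1 / (x + t)` and `log (x / t) / (x - t)` become `1 / (2 cosh (v / 2))` and `v / (2 sinh (v / 2))`,
whose Fourier transforms are `π / cosh πτ` and `(π / cosh πτ)²`: the first is an Euler beta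
integral, and the second kernel is the convolution square of the first. The kernel of the principal
value has the additional singularity `-1 / (2v)` at the origin. Comparing its truncations with the
conjugate Poisson kernel at Lebesgue points shows that the principal value exists almost everywhere
and acts as a bounded multiplier, which is `symbol` up to a constant factor.

Hence, for the Mellin transform `F` of `f`, equation (A) reads `symbol s * F s = λ * F (1 - s)`,
and, for the Mellin transform `φ` of `μ`, equation (C) reads
`(symbol s * symbol (1 - s) - λ²) * φ s = 0`. Given (A), the function `φ s = λ * (F s + F (1 - s))`
is symmetric and equals `(symbol s + λ) * F s`; conversely, `F = φ / (symbol + λ)` with `φ`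
symmetric solves (A) as soon as `φ` solves (C). Division by `symbol + λ` is possible because
`√(2π) ≤ |symbol|` on the critical line.
-/

open MeasureTheory Set Filter Topology

noncomputable section

namespace HartleyFourier

open scoped FourierTransform SchwartzMap ComplexConjugate ENNReal

/-! ### Fourier pairs of square integrable functions -/

lemma tendsto_eLpNorm_sub_of_dominated {α E ι : Type*} [MeasurableSpace α] {m : Measure α}
    [NormedAddCommGroup E] {p : ℝ≥0∞} (hp0 : p ≠ 0) (hp : p ≠ ∞) {l : Filter ι}
    [l.IsCountablyGenerated] {F : ι → α → E} {f : α → E} {bound : α → ℝ} (hbound : MemLp bound p m)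
    (hf : AEStronglyMeasurable f m) (hF : ∀ᶠ i in l, AEStronglyMeasurable (F i) m)
    (hle : ∀ᶠ i in l, ∀ᵐ x ∂m, ‖F i x - f x‖ ≤ bound x)
    (hlim : ∀ᵐ x ∂m, Tendsto (fun i => F i x) l (𝓝 (f x))) :
    Tendsto (fun i => eLpNorm (F i - f) p m) l (𝓝 0) := by
  have hp' : 0 < p.toReal := ENNReal.toReal_pos hp0 hp
  simp_rw [eLpNorm_eq_lintegral_rpow_enorm_toReal hp0 hp]
  have key : Tendsto (fun i => ∫⁻ x, ‖(F i - f) x‖ₑ ^ p.toReal ∂m) l (𝓝 (∫⁻ _, 0 ∂m)) := by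
    refine tendsto_lintegral_filter_of_dominated_convergence' (fun x => ‖bound x‖ₑ ^ p.toReal)
      ?_ ?_ (lintegral_rpow_enorm_lt_top_of_eLpNorm_lt_top hp0 hp hbound.2).ne ?_
    · filter_upwards [hF] with i hi using (hi.sub hf).enorm.pow_const _
    · filter_upwards [hle] with i hi
      filter_upwards [hi] with x hx
      exact ENNReal.rpow_le_rpow
        (enorm_le_iff_norm_le.2 (hx.trans (Real.le_norm_self _))) hp'.le
    · filter_upwards [hlim] with x hx
      have h := ((hx.sub_const (f x)).enorm).ennrpow_const p.toReal
      simpa [hp'] using h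
  simpa [hp'] using key.ennrpow_const (1 / p.toReal)

section FourierPair

variable {V E ι : Type*} [NormedAddCommGroup V] [InnerProductSpace ℝ V] [FiniteDimensional ℝ V]
  [MeasurableSpace V] [BorelSpace V] [NormedAddCommGroup E] [InnerProductSpace ℂ E]
  [CompleteSpace E]

/-- `G` represents the `L²` Fourier transform of the square integrable function `g`. -/
def IsFourierPair (g G : V → E) : Prop :=
  ∃ (hg : MemLp g 2) (hG : MemLp G 2), 𝓕 (hg.toLp g) = hG.toLp G

lemma exists_isFourierPair {g : V → E} (hg : MemLp g 2) : ∃ G, IsFourierPair g G :=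
  ⟨(𝓕 (hg.toLp g) : Lp E 2 volume), hg, Lp.memLp _, by rw [Lp.toLp_coeFn]⟩

lemma exists_isFourierPair_left {G : V → E} (hG : MemLp G 2) : ∃ g, IsFourierPair g G :=
  ⟨(𝓕⁻ (hG.toLp G) : Lp E 2 volume), Lp.memLp _, hG, by
    rw [Lp.toLp_coeFn, FourierTransform.fourier_fourierInv_eq]⟩

namespace IsFourierPair

variable {g g' G G' : V → E}

lemma memLp_left (h : IsFourierPair g G) : MemLp g 2 := h.1

lemma memLp_right (h : IsFourierPair g G) : MemLp G 2 := h.2.1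

lemma congr_left (h : IsFourierPair g G) (hg : g =ᵐ[volume] g') : IsFourierPair g' G := by
  obtain ⟨h1, h2, h3⟩ := h
  refine ⟨h1.ae_eq hg, h2, ?_⟩
  rw [← h3, MemLp.toLp_congr h1 (h1.ae_eq hg) hg]

lemma congr_right (h : IsFourierPair g G) (hG : G =ᵐ[volume] G') : IsFourierPair g G' := by
  obtain ⟨h1, h2, h3⟩ := h
  refine ⟨h1, h2.ae_eq hG, ?_⟩
  rw [h3, MemLp.toLp_congr h2 (h2.ae_eq hG) hG]

lemma unique_right (h : IsFourierPair g G) (h' : IsFourierPair g G') : G =ᵐ[volume] G' :=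
  (MemLp.toLp_eq_toLp_iff h.memLp_right h'.memLp_right).1 (h.2.2.symm.trans h'.2.2)

lemma unique_left (h : IsFourierPair g G) (h' : IsFourierPair g' G) : g =ᵐ[volume] g' :=
  (MemLp.toLp_eq_toLp_iff h.memLp_left h'.memLp_left).1
    ((Lp.fourierTransformₗᵢ V E).injective (h.2.2.trans h'.2.2.symm))

lemma add (h : IsFourierPair g G) (h' : IsFourierPair g' G') :
    IsFourierPair (g + g') (G + G') := by
  obtain ⟨h1, h2, h3⟩ := h
  obtain ⟨h1', h2', h3'⟩ := h'
  refine ⟨h1.add h1', h2.add h2', ?_⟩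
  rw [MemLp.toLp_add h1 h1', MemLp.toLp_add h2 h2', FourierTransform.fourier_add, h3, h3']

lemma const_smul (c : ℂ) (h : IsFourierPair g G) : IsFourierPair (c • g) (c • G) := by
  obtain ⟨h1, h2, h3⟩ := h
  refine ⟨h1.const_smul c, h2.const_smul c, ?_⟩
  rw [MemLp.toLp_const_smul c h1, MemLp.toLp_const_smul c h2, FourierTransform.fourier_smul, h3]

lemma sub (h : IsFourierPair g G) (h' : IsFourierPair g' G') :
    IsFourierPair (g - g') (G - G') := by
  simpa [sub_eq_add_neg] using h.add (h'.const_smul (-1))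

lemma eLpNorm_eq (h : IsFourierPair g G) : eLpNorm g 2 volume = eLpNorm G 2 volume := by
  obtain ⟨h1, h2, h3⟩ := h
  have := congrArg norm h3
  rw [Lp.norm_fourier_eq, Lp.norm_toLp, Lp.norm_toLp] at this
  exact (ENNReal.toReal_eq_toReal_iff' h1.2.ne h2.2.ne).1 this

lemma integral_inner (h : IsFourierPair g G) (h' : IsFourierPair g' G') :
    ∫ x, inner ℂ (g x) (g' x) = ∫ ξ, inner ℂ (G ξ) (G' ξ) := by
  have inner_toLp {p q : V → E} (hp : MemLp p 2) (hq : MemLp q 2) :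
      inner ℂ (hp.toLp p) (hq.toLp q) = ∫ x, inner ℂ (p x) (q x) := by
    rw [L2.inner_def]
    refine integral_congr_ae ?_
    filter_upwards [hp.coeFn_toLp, hq.coeFn_toLp] with x hx hx'
    rw [hx, hx']
  rw [← inner_toLp h.memLp_left h'.memLp_left, ← inner_toLp h.memLp_right h'.memLp_right,
    ← h.2.2, ← h'.2.2, Lp.inner_fourier_eq]

end IsFourierPair

section Limits

variable {l : Filter ι} [l.NeBot] [l.IsCountablyGenerated] {g G : V → E} {F Fhat : ι → V → E}

lemma IsFourierPair.of_tendsto_ae (hF : ∀ i, IsFourierPair (F i) (Fhat i)) (hg : MemLp g 2)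
    (hlim : Tendsto (fun i => eLpNorm (F i - g) 2 volume) l (𝓝 0))
    (hlim' : ∀ᵐ ξ, Tendsto (fun i => Fhat i ξ) l (𝓝 (G ξ))) : IsFourierPair g G := by
  obtain ⟨G', hG'⟩ := exists_isFourierPair hg
  have hmeas : TendstoInMeasure volume Fhat l G' := by
    refine tendstoInMeasure_of_tendsto_eLpNorm two_ne_zero
      (fun i => (hF i).memLp_right.1) hG'.memLp_right.1 ?_
    simpa only [((hF _).sub hG').eLpNorm_eq] using hlim
  obtain ⟨i, hi, hae⟩ := hmeas.exists_seq_tendsto_ae'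
  refine hG'.congr_right ?_
  filter_upwards [hae, hlim'] with ξ h h'
  exact tendsto_nhds_unique h (h'.comp hi)

lemma IsFourierPair.of_tendsto (hF : ∀ i, IsFourierPair (F i) (Fhat i)) (hg : MemLp g 2)
    (hG : MemLp G 2) (hlim : Tendsto (fun i => eLpNorm (F i - g) 2 volume) l (𝓝 0))
    (hlim' : Tendsto (fun i => eLpNorm (Fhat i - G) 2 volume) l (𝓝 0)) : IsFourierPair g G := by
  obtain ⟨i, hi, hae⟩ := (tendstoInMeasure_of_tendsto_eLpNorm two_ne_zero
    (fun i => (hF i).memLp_right.1) hG.1 hlim').exists_seq_tendsto_ae'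
  exact of_tendsto_ae (fun n => hF (i n)) hg (hlim.comp hi) hae

end Limits

lemma isFourierPair_iff_schwartz {g G : V → E} (hg : MemLp g 2) (hG : MemLp G 2) :
    IsFourierPair g G ↔ ∀ h : 𝓢(V, ℂ), ∫ ξ, h ξ • G ξ = ∫ x, 𝓕 h x • g x := by
  have hG_apply (h : 𝓢(V, ℂ)) :
      Lp.toTemperedDistribution (hG.toLp G) h = ∫ ξ, h ξ • G ξ := by
    rw [Lp.toTemperedDistribution_apply]
    refine integral_congr_ae ?_
    filter_upwards [hG.coeFn_toLp] with x hx
    rw [hx]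
  have hg_apply (h : 𝓢(V, ℂ)) :
      Lp.toTemperedDistribution (𝓕 (hg.toLp g)) h = ∫ x, 𝓕 h x • g x := by
    rw [← Lp.fourier_toTemperedDistribution_eq, TemperedDistribution.fourier_apply,
      Lp.toTemperedDistribution_apply]
    refine integral_congr_ae ?_
    filter_upwards [hg.coeFn_toLp] with x hx
    rw [hx]
  constructor
  · rintro ⟨_, _, hgG⟩ h
    rw [← hG_apply, ← hg_apply, hgG]
  · intro H
    refine ⟨hg, hG, ?_⟩
    have : (𝓕 (hg.toLp g) - hG.toLp G) ∈ (Lp.toTemperedDistributionCLM E volume 2).ker := by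
      rw [LinearMap.mem_ker, map_sub, sub_eq_zero]
      ext h
      exact (hg_apply h).trans ((H h).symm.trans (hG_apply h).symm)
    rw [Lp.ker_toTemperedDistributionCLM_eq_bot] at this
    exact sub_eq_zero.1 this

lemma IsFourierPair.symm_comp_neg {g G : V → E} (h : IsFourierPair g G) :
    IsFourierPair (fun x => G (-x)) g := by
  have hG : MemLp (fun x => G (-x)) 2 :=
    h.memLp_right.comp_measurePreserving (Measure.measurePreserving_neg volume)
  refine (isFourierPair_iff_schwartz hG h.memLp_left).2 fun s => ?_
  have key := (isFourierPair_iff_schwartz h.memLp_left h.memLp_right).1 h (𝓕⁻ s)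
  rw [FourierTransform.fourier_fourierInv_eq] at key
  rw [← key, ← integral_neg_eq_self]
  simp only [SchwartzMap.fourierInv_coe, Real.fourierInv_eq_fourier_neg, neg_neg,
    SchwartzMap.fourier_coe]

lemma IsFourierPair.comp_neg {g G : V → E} (h : IsFourierPair g G) :
    IsFourierPair (fun x => g (-x)) (fun ξ => G (-ξ)) :=
  h.symm_comp_neg.symm_comp_neg

lemma isFourierPair_fourier {p : V → E} (hp : Integrable p) (hp2 : MemLp p 2) :
    IsFourierPair p (𝓕 p) := by
  obtain ⟨P, hP⟩ := exists_isFourierPair hp2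
  refine hP.congr_right ?_
  refine ae_eq_of_integral_contDiff_smul_eq (hP.memLp_right.locallyIntegrable one_le_two)
    (VectorFourier.fourierIntegral_continuous Real.continuous_fourierChar continuous_inner
      hp).locallyIntegrable fun h hsmooth hsupp => ?_
  have hsupp' : HasCompactSupport (Complex.ofRealCLM ∘ h) := hsupp.comp_left rfl
  have hsmooth' : ContDiff ℝ (↑(⊤ : ℕ∞)) (Complex.ofRealCLM ∘ h) := by fun_prop
  have key := (isFourierPair_iff_schwartz hp2 hP.memLp_right).1 hP
    (hsupp'.toSchwartzMap hsmooth')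
  have flip := VectorFourier.integral_fourierIntegral_smul_eq_flip (L := innerₗ V)
    Real.continuous_fourierChar continuous_inner
    ((hsupp'.toSchwartzMap hsmooth').integrable (μ := volume)) hp
  rw [SchwartzMap.fourier_coe] at key
  simpa using! key.trans flip

lemma isFourierPair_fourierInv {P : V → E} (hP : Integrable P) (hP2 : MemLp P 2) :
    IsFourierPair (𝓕⁻ P) P := by
  rw [show 𝓕⁻ P = fun x => 𝓕 P (-x) from funext (Real.fourierInv_eq_fourier_neg P)]
  exact (isFourierPair_fourier hP hP2).symm_comp_neg

end FourierPair

section Convolution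

variable {V : Type*} [NormedAddCommGroup V] [InnerProductSpace ℝ V] [FiniteDimensional ℝ V]
  [MeasurableSpace V] [BorelSpace V] {g G κ K : V → ℂ}

open scoped Real

lemma fourier_conj_translate (κ : V → ℂ) (u ξ : V) :
    𝓕 (fun w => conj (κ (u - w))) ξ = conj (𝐞 (inner ℝ ξ u) * 𝓕 κ ξ) := by
  rw [Real.fourier_eq, Real.fourier_eq, ← integral_sub_left_eq_self _ volume u,
    ← integral_const_mul, ← integral_conj]
  refine integral_congr_ae (Eventually.of_forall fun v => ?_)
  simp only [Circle.smul_def, smul_eq_mul, map_mul, sub_sub_cancel, ← Circle.coe_inv_eq_conj,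
    ← AddChar.map_neg_eq_inv, ← mul_assoc, ← Circle.coe_mul, ← AddChar.map_add_eq_mul]
  rw [inner_sub_left, real_inner_comm u ξ]
  congr 4

lemma exists_seq_integrable_tendsto_eLpNorm {E : Type*} [NormedAddCommGroup E] [NormedSpace ℝ E]
    {p : ℝ≥0∞} (hp : p ≠ ∞) {f : V → E} (hf : MemLp f p) :
    ∃ φ : ℕ → V → E, (∀ n, Integrable (φ n)) ∧ (∀ n, MemLp (φ n) p) ∧
      Tendsto (fun n => eLpNorm (φ n - f) p volume) atTop (𝓝 0) := by
  have hne (n : ℕ) : (((n + 1 : ℕ) : ℝ≥0∞))⁻¹ ≠ 0 := by simp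
  choose φ hsupp hle hcont hφ using fun n =>
    hf.exists_hasCompactSupport_eLpNorm_sub_le hp (hne n)
  refine ⟨φ, fun n => (hcont n).integrable_of_hasCompactSupport (hsupp n), hφ, ?_⟩
  refine tendsto_of_tendsto_of_tendsto_of_le_of_le tendsto_const_nhds
    (ENNReal.tendsto_inv_nat_nhds_zero.comp (tendsto_add_atTop_nat 1)) (fun _ => zero_le)
    fun n => ?_
  exact (eLpNorm_sub_comm _ _ _ _).trans_le (hle n)

lemma IsFourierPair.conj_translate (h : IsFourierPair κ K) (u : V) :
    IsFourierPair (fun w => conj (κ (u - w))) (fun ξ => conj (𝐞 (inner ℝ ξ u) * K ξ)) := by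
  have hsub : MeasurePreserving (fun w : V => u - w) :=
    Measure.measurePreserving_sub_left volume u
  have hchar : Continuous fun ξ : V => (𝐞 (inner ℝ ξ u) : ℂ) := by fun_prop
  obtain ⟨φ, hφ1, hφ2, hlim⟩ := exists_seq_integrable_tendsto_eLpNorm (by simp) h.memLp_left
  refine of_tendsto (l := atTop) (F := fun n w => conj (φ n (u - w)))
    (Fhat := fun n ξ => conj (𝐞 (inner ℝ ξ u) * 𝓕 (φ n) ξ)) (fun n => ?_)
    (h.memLp_left.comp_measurePreserving hsub).star
    (h.memLp_right.congr_norm (hchar.aestronglyMeasurable.mul h.memLp_right.1).star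
      (Eventually.of_forall fun ξ => by rw [RCLike.norm_conj, norm_mul, Circle.norm_coe, one_mul]))
    ?_ ?_
  · rw [← funext (fourier_conj_translate (φ n) u)]
    exact isFourierPair_fourier
      ((Complex.conjLIE.integrable_comp_iff (φ := fun w => φ n (u - w))).2
        ((hφ1 n).comp_sub_left u))
      ((hφ2 n).comp_measurePreserving hsub).star
  · refine hlim.congr fun n => ?_
    rw [← eLpNorm_comp_measurePreserving ((hφ2 n).sub h.memLp_left).1 hsub]
    refine eLpNorm_congr_norm_ae (Eventually.of_forall fun w => ?_)
    simp [← map_sub]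
  · simp_rw [((isFourierPair_fourier (hφ1 _) (hφ2 _)).sub h).eLpNorm_eq] at hlim
    refine hlim.congr fun n => eLpNorm_congr_norm_ae (Eventually.of_forall fun ξ => ?_)
    rw [Pi.sub_apply, Pi.sub_apply, ← map_sub, ← mul_sub, RCLike.norm_conj, norm_mul,
      Circle.norm_coe, one_mul]

lemma IsFourierPair.integral_kernel_mul (hκ : IsFourierPair κ K) (h : IsFourierPair g G) (u : V) :
    ∫ w, κ (u - w) * g w = 𝓕⁻ (fun ξ => K ξ * G ξ) u := by
  have key := (hκ.conj_translate u).integral_inner h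
  simp only [RCLike.inner_apply, Complex.conj_conj] at key
  rw [Real.fourierInv_eq]
  calc ∫ w, κ (u - w) * g w = ∫ w, g w * κ (u - w) := by simp only [mul_comm]
    _ = ∫ ξ, G ξ * (𝐞 (inner ℝ ξ u) * K ξ) := key
    _ = _ := by
      refine integral_congr_ae (Eventually.of_forall fun ξ => ?_)
      simp only [Circle.smul_def, smul_eq_mul]
      ring

lemma memLp_top_fourier (hκ : Integrable κ) : MemLp (𝓕 κ) ∞ :=
  memLp_top_of_bound
    (VectorFourier.fourierIntegral_continuous Real.continuous_fourierChar continuous_inner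
      hκ).aestronglyMeasurable
    (∫ v, ‖κ v‖) (.of_forall (VectorFourier.norm_fourierIntegral_le_integral_norm _ _ _ κ))

theorem IsFourierPair.convolution (hκ : IsFourierPair κ K) (h : IsFourierPair g G)
    (hK : MemLp K ∞) :
    IsFourierPair (fun u => ∫ w, κ (u - w) * g w) (fun ξ => K ξ * G ξ) := by
  have hKG : MemLp (fun ξ => K ξ * G ξ) 2 := h.memLp_right.mul hK
  refine (isFourierPair_fourierInv (hκ.memLp_right.integrable_mul h.memLp_right)
    hKG).congr_left (Eventually.of_forall fun u => ?_)
  exact (hκ.integral_kernel_mul h u).symm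

end Convolution

/-! ### Logarithmic coordinates -/

section LogCoordinates

variable {E : Type*} [NormedAddCommGroup E] [NormedSpace ℝ E]

lemma measurableEmbedding_exp : MeasurableEmbedding Real.exp :=
  Real.isOpenEmbedding_exp.measurableEmbedding

lemma lintegral_halfLine (F : ℝ → ℝ≥0∞) :
    ∫⁻ x, F x ∂halfLine = ∫⁻ u, ENNReal.ofReal (Real.exp u) * F (Real.exp u) := by
  have h := lintegral_image_eq_lintegral_abs_deriv_mul MeasurableSet.univ
    (fun x _ => (Real.hasDerivAt_exp x).hasDerivWithinAt) Real.exp_injective.injOn F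
  rw [image_univ, Real.range_exp] at h
  simpa only [halfLine, Real.abs_exp, setLIntegral_univ] using h

lemma integral_Ioi_eq_integral_exp_smul (F : ℝ → E) :
    ∫ t in Ioi (0 : ℝ), F t = ∫ w, Real.exp w • F (Real.exp w) := by
  have h := integral_image_eq_integral_abs_deriv_smul MeasurableSet.univ
    (fun x _ => (Real.hasDerivAt_exp x).hasDerivWithinAt) Real.exp_injective.injOn F
  rw [image_univ, Real.range_exp] at h
  simpa only [Real.abs_exp, setIntegral_univ] using h

lemma integrableOn_Ioi_iff_exp_smul (F : ℝ → E) :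
    IntegrableOn F (Ioi 0) ↔ Integrable fun w => Real.exp w • F (Real.exp w) := by
  have h := integrableOn_image_iff_integrableOn_abs_deriv_smul MeasurableSet.univ
    (fun x _ => (Real.hasDerivAt_exp x).hasDerivWithinAt) Real.exp_injective.injOn F
  rw [image_univ, Real.range_exp] at h
  simpa only [Real.abs_exp, integrableOn_univ] using h

/-- Lebesgue measure on `ℝ` with density `e^u`, whose image under `exp` is `halfLine`. -/
def expMeasure : Measure ℝ := volume.withDensity fun u => ENNReal.ofReal (Real.exp u)

lemma map_exp_expMeasure : expMeasure.map Real.exp = halfLine := by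
  refine Measure.ext_of_lintegral _ fun F hF => ?_
  rw [lintegral_halfLine, lintegral_map hF Real.measurable_exp, expMeasure]
  exact lintegral_withDensity_eq_lintegral_mul _ (by fun_prop) (hF.comp Real.measurable_exp)

lemma ae_halfLine_iff {P : ℝ → Prop} :
    (∀ᵐ x ∂halfLine, P x) ↔ ∀ᵐ u : ℝ, P (Real.exp u) := by
  rw [← map_exp_expMeasure, measurableEmbedding_exp.ae_map_iff, expMeasure,
    ae_withDensity_iff (by fun_prop)]
  simp [Real.exp_pos]

lemma aestronglyMeasurable_halfLine_iff {X : Type*} [TopologicalSpace X] {f : ℝ → X} :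
    AEStronglyMeasurable f halfLine ↔ AEStronglyMeasurable (fun u => f (Real.exp u)) volume := by
  rw [← map_exp_expMeasure, measurableEmbedding_exp.aestronglyMeasurable_map_iff]
  refine ⟨fun h => h.mono_ac ?_, fun h => h.mono_ac (withDensity_absolutelyContinuous _ _)⟩
  exact withDensity_absolutelyContinuous' (by fun_prop)
    (Eventually.of_forall fun u => by simp [Real.exp_pos])

/-- The unitary change of variables `f ↦ e^{u/2} f(e^u)` from `L₂(ℝ₊)` to `L₂(ℝ)`. -/
def logPullback (f : ℝ → E) (u : ℝ) : E := Real.exp (u / 2) • f (Real.exp u)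

lemma logPullback_sub (f g : ℝ → E) :
    logPullback (fun x => f x - g x) = logPullback f - logPullback g :=
  funext fun _ => smul_sub _ _ _

lemma exp_neg_half_smul_logPullback (f : ℝ → E) (u : ℝ) :
    Real.exp (-(u / 2)) • logPullback f u = f (Real.exp u) := by
  rw [logPullback, smul_smul, ← Real.exp_add, neg_add_cancel, Real.exp_zero, one_smul]

lemma eLpNorm_halfLine (f : ℝ → E) :
    eLpNorm f 2 halfLine = eLpNorm (logPullback f) 2 volume := by
  rw [eLpNorm_eq_lintegral_rpow_enorm_toReal two_ne_zero ENNReal.ofNat_ne_top,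
    eLpNorm_eq_lintegral_rpow_enorm_toReal two_ne_zero ENNReal.ofNat_ne_top, lintegral_halfLine]
  congr 1
  refine lintegral_congr fun u => ?_
  rw [logPullback, enorm_smul, ENNReal.mul_rpow_of_nonneg _ _ ENNReal.toReal_nonneg]
  congr 1
  rw [Real.enorm_of_nonneg (Real.exp_pos _).le, ENNReal.ofReal_rpow_of_pos (Real.exp_pos _),
    ← Real.exp_mul, ENNReal.toReal_ofNat, div_mul_cancel₀ u two_ne_zero]

lemma memLp_halfLine_iff {f : ℝ → E} :
    MemLp f 2 halfLine ↔ MemLp (logPullback f) 2 volume := by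
  rw [MemLp, MemLp, eLpNorm_halfLine, aestronglyMeasurable_halfLine_iff]
  refine and_congr_left fun _ => ⟨fun h => ?_, fun h => ?_⟩
  · exact AEStronglyMeasurable.smul (by fun_prop) h
  · rw [← funext (exp_neg_half_smul_logPullback f)]
    exact AEStronglyMeasurable.smul (by fun_prop) h

end LogCoordinates

/-! ### The inverse Mellin transform as a Fourier transform -/

/-- The parameter `τ = -2πξ` of the point of the critical line attached to the frequency `ξ`. -/
def freq (ξ : ℝ) : ℝ := -(2 * Real.pi) * ξ

lemma freq_neg (ξ : ℝ) : freq (-ξ) = -freq ξ := mul_neg _ _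

lemma measurableEmbedding_freq : MeasurableEmbedding freq :=
  (Homeomorph.mulLeft₀ (-(2 * Real.pi)) (by simp [Real.pi_ne_zero])).measurableEmbedding

lemma map_freq_volume :
    Measure.map freq volume = ENNReal.ofReal (2 * Real.pi)⁻¹ • volume := by
  rw [show freq = (-(2 * Real.pi) * ·) from rfl,
    Real.map_volume_mul_left (by simp [Real.pi_ne_zero]), inv_neg, abs_neg,
    abs_of_pos (by positivity)]

lemma ae_freq_iff {P : ℝ → Prop} : (∀ᵐ ξ, P (freq ξ)) ↔ ∀ᵐ τ, P τ := by
  rw [← measurableEmbedding_freq.ae_map_iff, map_freq_volume, Measure.ae_ennreal_smul_measure_iff]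
  simp [Real.pi_pos]

lemma memLp_comp_freq_iff {E : Type*} [NormedAddCommGroup E] {p : ℝ≥0∞} {F : ℝ → E} :
    MemLp (fun ξ => F (freq ξ)) p ↔ MemLp F p := by
  have hc : ENNReal.ofReal (2 * Real.pi)⁻¹ ≠ 0 := by simp [Real.pi_pos]
  refine measurableEmbedding_freq.memLp_map_measure_iff.symm.trans ?_
  rw [map_freq_volume]
  refine ⟨fun h => ?_, fun h => h.smul_measure ENNReal.ofReal_ne_top⟩
  have h' := h.smul_measure (ENNReal.inv_ne_top.2 hc)
  rwa [smul_smul, ENNReal.inv_mul_cancel hc ENNReal.ofReal_ne_top, one_smul] at h'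

/-- The integrand of the truncated inverse Mellin transform, as a function of the frequency. -/
def truncFreq (G : ℂ → ℂ) (N ξ : ℝ) : ℂ :=
  (Ioc (-N) N).indicator (fun τ => G (line τ)) (freq ξ)

lemma memLp_truncFreq {G : ℂ → ℂ} (hG : MemL2Line G) (N : ℝ) : MemLp (truncFreq G N) 2 :=
  memLp_comp_freq_iff.2 (hG.indicator measurableSet_Ioc)

lemma integrable_truncFreq {G : ℂ → ℂ} (hG : MemL2Line G) (N : ℝ) :
    Integrable (truncFreq G N) := by
  have : IsFiniteMeasure (volume.restrict (Ioc (-N) N)) := ⟨by simp⟩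
  have h : IntegrableOn (fun τ => G (line τ)) (Ioc (-N) N) :=
    (hG.restrict _).integrable one_le_two
  exact ((integrable_indicator_iff measurableSet_Ioc).2 h).comp_mul_left'
    (by simp [Real.pi_ne_zero])

lemma tendsto_truncFreq {G : ℂ → ℂ} (hG : MemL2Line G) :
    Tendsto (fun N => eLpNorm (truncFreq G N - fun ξ => G (line (freq ξ))) 2 volume)
      atTop (𝓝 0) := by
  have hG' : MemLp (fun ξ => G (line (freq ξ))) 2 := memLp_comp_freq_iff.2 hG
  refine tendsto_eLpNorm_sub_of_dominated two_ne_zero ENNReal.ofNat_ne_top hG'.norm hG'.1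
    (Eventually.of_forall fun N => (memLp_truncFreq hG N).1)
    (Eventually.of_forall fun N => ae_of_all _ fun ξ => ?_) (ae_of_all _ fun ξ => ?_)
  · simp only [truncFreq, indicator]
    split_ifs <;> simp
  · refine tendsto_const_nhds.congr' ?_
    filter_upwards [eventually_gt_atTop |freq ξ|] with N hN
    rw [truncFreq, indicator_of_mem]
    exact ⟨(abs_lt.1 hN).1, (abs_lt.1 hN).2.le⟩

lemma exp_half_mul_exp_cpow_neg_line (u τ : ℝ) :
    (Real.exp (u / 2) : ℂ) * (Real.exp u : ℂ) ^ (-line τ)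
      = Complex.exp (-(τ * u) * Complex.I) := by
  rw [Complex.cpow_def_of_ne_zero (by exact_mod_cast (Real.exp_pos u).ne'), ← Complex.ofReal_log
    (Real.exp_pos u).le, Real.log_exp, Complex.ofReal_exp, ← Complex.exp_add]
  congr 1
  simp only [line]
  push_cast
  ring

lemma logPullback_truncInvMellin (G : ℂ → ℂ) {N : ℝ} (hN : 0 ≤ N) :
    logPullback (truncInvMellin G N) = 𝓕⁻ (truncFreq G N) := by
  ext u
  set Φ : ℝ → ℂ := (Ioc (-N) N).indicator fun τ =>
    G (line τ) * ((Real.exp (u / 2) : ℂ) * (Real.exp u : ℂ) ^ (-line τ)) with hΦ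
  have fourierInv_integrand (ξ : ℝ) :
      Complex.exp (↑(2 * Real.pi * inner ℝ ξ u) * Complex.I) • truncFreq G N ξ
        = Φ (-(2 * Real.pi) * ξ) := by
    have hexp : ((2 * Real.pi * inner ℝ ξ u : ℝ) : ℂ) = -(freq ξ * u) := by
      simp [freq]
      ring
    rw [hexp, ← exp_half_mul_exp_cpow_neg_line, truncFreq, ← freq, hΦ, smul_eq_mul]
    by_cases h : freq ξ ∈ Ioc (-N) N
    · rw [indicator_of_mem h, indicator_of_mem h, mul_comm]
    · rw [indicator_of_notMem h, indicator_of_notMem h, mul_zero]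
  rw [Real.fourierInv_eq', integral_congr_ae (ae_of_all _ fourierInv_integrand),
    Measure.integral_comp_mul_left Φ, inv_neg, abs_neg, abs_of_pos (by positivity),
    integral_indicator measurableSet_Ioc, logPullback, truncInvMellin,
    intervalIntegral.integral_of_le (by linarith)]
  simp only [Complex.real_smul, mul_left_comm (G _), integral_const_mul]
  push_cast
  ring

theorem isInvMellin_iff_isFourierPair {G : ℂ → ℂ} {f : ℝ → ℂ} :
    IsInvMellin G f ↔ IsFourierPair (logPullback f) (fun ξ => G (line (freq ξ))) := by
  have trunc_pair (hG : MemL2Line G) {N : ℝ} (hN : 0 ≤ N) :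
      IsFourierPair (logPullback (truncInvMellin G N)) (truncFreq G N) := by
    rw [logPullback_truncInvMellin G hN]
    exact isFourierPair_fourierInv (integrable_truncFreq hG N) (memLp_truncFreq hG N)
  have eLpNorm_trunc (N : ℝ) : eLpNorm (fun x => truncInvMellin G N x - f x) 2 halfLine
      = eLpNorm (logPullback (truncInvMellin G N) - logPullback f) 2 volume := by
    rw [eLpNorm_halfLine, logPullback_sub]
  constructor
  · rintro ⟨hG, hf, hlim⟩
    simp only [eLpNorm_trunc] at hlim
    exact .of_tendsto (fun n : ℕ => trunc_pair hG n.cast_nonneg) (memLp_halfLine_iff.1 hf)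
      (memLp_comp_freq_iff.2 hG) (hlim.comp tendsto_natCast_atTop_atTop)
      ((tendsto_truncFreq hG).comp tendsto_natCast_atTop_atTop)
  · intro h
    have hG : MemL2Line G := memLp_comp_freq_iff.1 h.memLp_right
    refine ⟨hG, memLp_halfLine_iff.2 h.memLp_left, ?_⟩
    refine (tendsto_truncFreq hG).congr' ?_
    filter_upwards [eventually_ge_atTop 0] with N hN
    rw [eLpNorm_trunc, ((trunc_pair hG hN).sub h).eLpNorm_eq]

/-! ### The hyperbolic kernels -/

open scoped Convolution

lemma fourier_eq_integral_freq (κ : ℝ → ℂ) (ξ : ℝ) :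
    𝓕 κ ξ = ∫ v, κ v * Complex.exp (freq ξ * v * Complex.I) := by
  rw [Real.fourier_eq']
  refine integral_congr_ae (Eventually.of_forall fun v => ?_)
  simp only [smul_eq_mul, freq, Real.inner_apply, mul_comm _ (κ v)]
  congr 2
  push_cast
  ring

/-- The kernel `1 / (2 cosh (v/2))`, the logarithmic form of `1 / (x + t)`. -/
def sechKernel (v : ℝ) : ℝ := 1 / (2 * Real.cosh (v / 2))

/-- The kernel `1 / (2 sinh (v/2))`, the logarithmic form of `1 / (x - t)`; it is `0` at its
pole. -/
def cschKernel (v : ℝ) : ℝ := 1 / (2 * Real.sinh (v / 2))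

/-- The kernel `v / (2 sinh (v/2))`, the logarithmic form of `log (x / t) / (x - t)`; it is `0`,
not `1`, at the removable singularity. -/
def logKernel (v : ℝ) : ℝ := v * cschKernel v

lemma sechKernel_pos (v : ℝ) : 0 < sechKernel v :=
  one_div_pos.2 (mul_pos two_pos (Real.cosh_pos _))

lemma sechKernel_le_one (v : ℝ) : sechKernel v ≤ 1 := by
  rw [sechKernel, div_le_one (mul_pos two_pos (Real.cosh_pos _))]
  linarith [Real.one_le_cosh (v / 2)]

lemma sechKernel_neg (v : ℝ) : sechKernel (-v) = sechKernel v := by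
  simp only [sechKernel, neg_div, Real.cosh_neg]

lemma cschKernel_neg (v : ℝ) : cschKernel (-v) = -cschKernel v := by
  simp only [cschKernel, neg_div, Real.sinh_neg, mul_neg, div_neg]

lemma abs_cschKernel (v : ℝ) : |cschKernel v| = cschKernel |v| := by
  simp only [cschKernel, abs_div, abs_mul, abs_one, Nat.abs_ofNat, Real.abs_sinh]

lemma abs_cschKernel_le_inv (v : ℝ) : |cschKernel v| ≤ |v|⁻¹ := by
  rcases eq_or_ne v 0 with rfl | hv
  · simp [cschKernel]
  · have := Real.self_le_sinh_iff.2 (half_pos (abs_pos.2 hv)).le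
    rw [abs_cschKernel, cschKernel, one_div]
    exact inv_anti₀ (abs_pos.2 hv) (by linarith)

lemma logKernel_eq_abs_mul_abs (v : ℝ) : logKernel v = |v| * |cschKernel v| := by
  rw [abs_cschKernel]
  rcases abs_choice v with h | h <;> rw [h, logKernel]
  rw [cschKernel_neg, neg_mul_neg]

lemma logKernel_nonneg (v : ℝ) : 0 ≤ logKernel v := by
  rw [logKernel_eq_abs_mul_abs]; positivity

lemma logKernel_le_one (v : ℝ) : logKernel v ≤ 1 := by
  rw [logKernel_eq_abs_mul_abs]
  exact (mul_le_mul_of_nonneg_left (abs_cschKernel_le_inv v) (abs_nonneg v)).trans mul_inv_le_one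

lemma logKernel_neg (v : ℝ) : logKernel (-v) = logKernel v := by
  rw [logKernel, cschKernel_neg, neg_mul_neg, logKernel]

lemma measurable_sechKernel : Measurable sechKernel := by
  unfold sechKernel; fun_prop

lemma measurable_cschKernel : Measurable cschKernel := by
  unfold cschKernel; fun_prop

lemma measurable_logKernel : Measurable logKernel := measurable_id.mul measurable_cschKernel

lemma abs_mul_sechKernel_le_logKernel (v : ℝ) : |v * sechKernel v| ≤ logKernel v := by
  rcases eq_or_ne v 0 with rfl | hv
  · simp [logKernel]
  · rw [logKernel_eq_abs_mul_abs, abs_mul, abs_cschKernel]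
    refine mul_le_mul_of_nonneg_left ?_ (abs_nonneg v)
    have hcosh : Real.cosh (|v| / 2) = Real.cosh (v / 2) := by
      rw [← Real.cosh_abs (v / 2), abs_div, Nat.abs_ofNat]
    rw [abs_of_pos (sechKernel_pos v), sechKernel, cschKernel]
    exact one_div_le_one_div_of_le
      (mul_pos two_pos (Real.sinh_pos_iff.2 (half_pos (abs_pos.2 hv))))
      (by linarith [Real.sinh_lt_cosh (|v| / 2)])

lemma log_sigmoid (v : ℝ) : Real.log (Real.sigmoid v) = v / 2 + Real.log (sechKernel v) := by
  have h : Real.sigmoid v = Real.exp (v / 2) * sechKernel v := by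
    have hv : Real.exp (-v) = Real.exp (-(v / 2)) ^ 2 := by rw [← Real.exp_nat_mul]; ring_nf
    rw [Real.sigmoid_def, sechKernel, Real.cosh_eq, hv, Real.exp_neg (v / 2)]
    field_simp
  rw [h, Real.log_mul (Real.exp_pos _).ne' (sechKernel_pos v).ne', Real.log_exp]

lemma line_re (τ : ℝ) : (line τ).re = 1 / 2 := by simp [line]

lemma one_sub_line (τ : ℝ) : 1 - line τ = line (-τ) := by
  simp only [line]; push_cast; ring

lemma sigmoid_beta_integrand (τ v : ℝ) :
    |Real.sigmoid v * (1 - Real.sigmoid v)| • ((Real.sigmoid v : ℂ) ^ (line τ - 1) *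
      (1 - (Real.sigmoid v : ℂ)) ^ ((1 - line τ) - 1))
      = (sechKernel v : ℂ) * Complex.exp (τ * v * Complex.I) := by
  have cpow_eq {y : ℝ} (hy : 0 < y) (s : ℂ) : (y : ℂ) ^ s = Complex.exp (Real.log y * s) := by
    rw [Complex.cpow_def_of_ne_zero (Complex.ofReal_ne_zero.2 hy.ne'), Complex.ofReal_log hy.le]
  have eq_exp {y : ℝ} (hy : 0 < y) : (y : ℂ) = Complex.exp (Real.log y) := by
    rw [← Complex.ofReal_exp, Real.exp_log hy]
  have hpos := Real.sigmoid_pos v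
  have hpos' := Real.sigmoid_pos (-v)
  have hsub : 1 - (Real.sigmoid v : ℂ) = (Real.sigmoid (-v) : ℝ) := by
    rw [Real.sigmoid_neg]; push_cast; rfl
  rw [← Real.sigmoid_neg, abs_of_pos (mul_pos hpos hpos'), Complex.real_smul, Complex.ofReal_mul,
    hsub, cpow_eq hpos, cpow_eq hpos', eq_exp hpos, eq_exp hpos', eq_exp (sechKernel_pos v),
    log_sigmoid, log_sigmoid, sechKernel_neg]
  simp only [← Complex.exp_add]
  congr 1
  simp only [line]
  push_cast
  ring

lemma integrable_sechKernel_mul_exp (τ : ℝ) :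
    Integrable fun v : ℝ => (sechKernel v : ℂ) * Complex.exp (τ * v * Complex.I) := by
  have h := Complex.betaIntegral_convergent (u := line τ) (v := 1 - line τ)
    (by rw [line_re]; norm_num) (by rw [one_sub_line, line_re]; norm_num)
  rw [intervalIntegrable_iff_integrableOn_Ioo_of_le zero_le_one, ← Real.range_sigmoid,
    ← image_univ, integrableOn_image_iff_integrableOn_abs_deriv_smul MeasurableSet.univ
    (fun x _ => (Real.hasDerivAt_sigmoid x).hasDerivWithinAt) Real.sigmoid_injective.injOn,
    integrableOn_univ] at h
  exact h.congr (Eventually.of_forall (sigmoid_beta_integrand τ))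

-- The substitution `t = sigmoid v` turns `B(s, 1 - s) = Γ(s) Γ(1 - s)` into this integral.
lemma integral_sechKernel_mul_exp (τ : ℝ) :
    ∫ v : ℝ, (sechKernel v : ℂ) * Complex.exp (τ * v * Complex.I)
      = (Real.pi / Real.cosh (Real.pi * τ) : ℝ) := by
  have h := Complex.Gamma_mul_Gamma_eq_betaIntegral (s := line τ) (t := 1 - line τ)
    (by rw [line_re]; norm_num) (by rw [one_sub_line, line_re]; norm_num)
  rw [Complex.Gamma_mul_Gamma_one_sub, add_sub_cancel, Complex.Gamma_one, one_mul,
    Complex.betaIntegral, intervalIntegral.integral_of_le zero_le_one, integral_Ioc_eq_integral_Ioo,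
    ← Real.range_sigmoid, ← image_univ,
    integral_image_eq_integral_abs_deriv_smul MeasurableSet.univ
    (fun x _ => (Real.hasDerivAt_sigmoid x).hasDerivWithinAt) Real.sigmoid_injective.injOn] at h
  simp only [sigmoid_beta_integrand, Measure.restrict_univ] at h
  have hsin : Complex.sin (Real.pi * line τ) = (Real.cosh (Real.pi * τ) : ℝ) := by
    have e : (Real.pi : ℂ) * line τ = Real.pi * τ * Complex.I + Real.pi / 2 := by
      simp only [line]; ring
    rw [e, Complex.sin_add_pi_div_two, Complex.cos_mul_I]
    push_cast; rfl
  rw [← h, hsin]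
  push_cast; rfl

lemma integrable_sechKernel : Integrable sechKernel := by
  simpa using (integrable_sechKernel_mul_exp 0).re

lemma tendsto_log_cosh_sub_atTop :
    Tendsto (fun y => Real.log (Real.cosh y) - y) atTop (𝓝 (Real.log (1 / 2))) := by
  have h1 (y : ℝ) : Real.log (Real.cosh y) - y = Real.log ((1 + Real.exp (-(2 * y))) / 2) := by
    have hy : Real.exp (-(2 * y)) = Real.exp (-y) ^ 2 := by rw [← Real.exp_nat_mul]; ring_nf
    nth_rw 2 [← Real.log_exp y]
    rw [← Real.log_div (Real.cosh_pos _).ne' (Real.exp_pos _).ne', Real.cosh_eq, hy, Real.exp_neg]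
    congr 1
    field_simp
  have h2 : Tendsto (fun y : ℝ => Real.exp (-(2 * y))) atTop (𝓝 0) :=
    Real.tendsto_exp_neg_atTop_nhds_zero.comp (tendsto_id.const_mul_atTop (by norm_num))
  simp_rw [h1]
  refine (Real.continuousAt_log (by norm_num)).tendsto.comp ?_
  simpa using (h2.const_add 1).div_const 2

lemma hasDerivAt_log_cosh_half_sub (x t : ℝ) :
    HasDerivAt (fun t => Real.log (Real.cosh (t / 2)) - Real.log (Real.cosh ((x - t) / 2)))
      (2 * Real.sinh (x / 2) * (sechKernel t * sechKernel (x - t))) t := by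
  have d1 := (((hasDerivAt_id t).div_const 2).cosh).log (Real.cosh_pos _).ne'
  have d2 := ((((hasDerivAt_id t).const_sub x).div_const 2).cosh).log (Real.cosh_pos _).ne'
  have hsinh : Real.sinh (x / 2) = Real.sinh (t / 2) * Real.cosh ((x - t) / 2)
      + Real.cosh (t / 2) * Real.sinh ((x - t) / 2) := by
    rw [← Real.sinh_add]; ring_nf
  refine (d1.sub d2).congr_deriv ?_
  have c1 := (Real.cosh_pos (t / 2)).ne'
  have c2 := (Real.cosh_pos ((x - t) / 2)).ne'
  simp only [id, hsinh, sechKernel]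
  field_simp
  ring

lemma tendsto_log_cosh_half_sub_atTop (x : ℝ) :
    Tendsto (fun t => Real.log (Real.cosh (t / 2)) - Real.log (Real.cosh ((x - t) / 2))) atTop
      (𝓝 (x / 2)) := by
  have t1 := tendsto_log_cosh_sub_atTop.comp (tendsto_id.atTop_div_const (two_pos (α := ℝ)))
  have t2 := tendsto_log_cosh_sub_atTop.comp
    ((tendsto_atTop_add_const_right atTop (-x) tendsto_id).atTop_div_const (two_pos (α := ℝ)))
  have t3 := (t1.sub t2).add_const (x / 2)
  rw [sub_self, zero_add] at t3
  refine t3.congr fun t => ?_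
  have hcosh : Real.cosh ((x - t) / 2) = Real.cosh ((t + -x) / 2) := by
    rw [← Real.cosh_neg]; ring_nf
  simp only [Function.comp, id, hcosh]
  ring

lemma tendsto_log_cosh_half_sub_atBot (x : ℝ) :
    Tendsto (fun t => Real.log (Real.cosh (t / 2)) - Real.log (Real.cosh ((x - t) / 2))) atBot
      (𝓝 (-(x / 2))) := by
  refine ((tendsto_log_cosh_half_sub_atTop x).comp
    (tendsto_atTop_add_const_left atBot x tendsto_neg_atBot_atTop)).neg.congr fun t => ?_
  simp only [Function.comp]
  ring_nf

lemma integral_sechKernel_mul_sechKernel_sub {x : ℝ} (hx : x ≠ 0) :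
    ∫ t, sechKernel t * sechKernel (x - t) = logKernel x := by
  have hsinh : Real.sinh (x / 2) ≠ 0 := by
    rw [Ne, Real.sinh_eq_zero]; simpa using hx
  have hint : Integrable fun t => sechKernel t * sechKernel (x - t) := by
    refine (integrable_sechKernel.comp_sub_left x).bdd_mul (c := 1)
      measurable_sechKernel.aestronglyMeasurable (Eventually.of_forall fun t => ?_)
    rw [Real.norm_of_nonneg (sechKernel_pos t).le]
    exact sechKernel_le_one t
  have h := integral_of_hasDerivAt_of_tendsto (hasDerivAt_log_cosh_half_sub x)
    (hint.const_mul _) (tendsto_log_cosh_half_sub_atBot x) (tendsto_log_cosh_half_sub_atTop x)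
  rw [integral_const_mul] at h
  rw [logKernel, cschKernel]
  field_simp
  linarith

lemma sechKernel_convolution_sechKernel :
    ((fun v => (sechKernel v : ℂ)) ⋆[ContinuousLinearMap.mul ℂ ℂ] fun v => (sechKernel v : ℂ))
      =ᵐ[volume] fun v => (logKernel v : ℂ) := by
  filter_upwards [volume.ae_ne 0] with x hx
  rw [convolution_def, ← integral_sechKernel_mul_sechKernel_sub hx, ← integral_complex_ofReal]
  simp

lemma integrable_logKernel : Integrable logKernel := by
  simpa using ((integrable_sechKernel.ofReal.integrable_convolution _
    integrable_sechKernel.ofReal).congr sechKernel_convolution_sechKernel).re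

lemma fourier_sechKernel (ξ : ℝ) :
    𝓕 (fun v => (sechKernel v : ℂ)) ξ = (Real.pi / Real.cosh (Real.pi * freq ξ) : ℝ) := by
  rw [fourier_eq_integral_freq, integral_sechKernel_mul_exp]

lemma fourier_logKernel (ξ : ℝ) :
    𝓕 (fun v => (logKernel v : ℂ)) ξ = ((Real.pi / Real.cosh (Real.pi * freq ξ)) ^ 2 : ℝ) := by
  have hsech : Integrable fun v => (sechKernel v : ℂ) := integrable_sechKernel.ofReal
  have h := Real.fourier_mul_convolution_eq hsech hsech ξ
  rw [← Real.fourier_congr_ae sechKernel_convolution_sechKernel, h, fourier_sechKernel]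
  push_cast
  ring

lemma memLp_two_of_integrable_of_norm_le {α E : Type*} {m : MeasurableSpace α} {μ : Measure α}
    [NormedAddCommGroup E] {κ : α → E} (hκ : Integrable κ μ) {C : ℝ} (hC : ∀ v, ‖κ v‖ ≤ C) :
    MemLp κ 2 μ := by
  rw [memLp_two_iff_integrable_sq_norm hκ.1]
  have h : Integrable (fun v => ‖κ v‖ * ‖κ v‖) μ :=
    hκ.norm.bdd_mul (c := C) hκ.1.norm (Eventually.of_forall fun v => by simpa using hC v)
  simpa only [sq] using h

lemma memLp_sechKernel : MemLp (fun v => (sechKernel v : ℂ)) 2 :=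
  memLp_two_of_integrable_of_norm_le integrable_sechKernel.ofReal fun v => by
    rw [Complex.norm_real, Real.norm_of_nonneg (sechKernel_pos v).le]
    exact sechKernel_le_one v

lemma memLp_logKernel : MemLp (fun v => (logKernel v : ℂ)) 2 :=
  memLp_two_of_integrable_of_norm_le integrable_logKernel.ofReal fun v => by
    rw [Complex.norm_real, Real.norm_of_nonneg (logKernel_nonneg v)]
    exact logKernel_le_one v

lemma integrable_mul_sechKernel : Integrable fun v => v * sechKernel v :=
  integrable_logKernel.mono' (measurable_id.mul measurable_sechKernel).aestronglyMeasurable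
    (Eventually.of_forall abs_mul_sechKernel_le_logKernel)

lemma hasDerivAt_pi_div_cosh_pi_mul (τ : ℝ) :
    HasDerivAt (fun t => Real.pi / Real.cosh (Real.pi * t))
      (-(Real.pi ^ 2 * Real.sinh (Real.pi * τ) / Real.cosh (Real.pi * τ) ^ 2)) τ := by
  refine ((hasDerivAt_const τ Real.pi).div ((hasDerivAt_id τ).const_mul Real.pi).cosh
    (Real.cosh_pos _).ne').congr_deriv ?_
  simp only [id]
  ring

lemma fourier_mul_sechKernel (ξ : ℝ) :
    𝓕 (fun v => ((v * sechKernel v : ℝ) : ℂ)) ξ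
      = (Real.pi ^ 2 * Real.sinh (Real.pi * freq ξ) / Real.cosh (Real.pi * freq ξ) ^ 2 : ℝ)
        * Complex.I := by
  have hsmul : Integrable fun v : ℝ => v • (sechKernel v : ℂ) := by
    refine integrable_mul_sechKernel.ofReal.congr (Eventually.of_forall fun v => ?_)
    exact Complex.ofReal_mul v (sechKernel v)
  have h1 := Real.hasDerivAt_fourier integrable_sechKernel.ofReal hsmul ξ
  have h2 : HasDerivAt (𝓕 fun v => (sechKernel v : ℂ)) _ ξ :=
    ((((hasDerivAt_pi_div_cosh_pi_mul (freq ξ)).comp ξ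
      ((hasDerivAt_id ξ).const_mul (-(2 * Real.pi))))).ofReal_comp).congr_of_eventuallyEq
        (Eventually.of_forall fourier_sechKernel)
  have h3 : 𝓕 (fun v : ℝ => (-2 * Real.pi * Complex.I * v) • (sechKernel v : ℂ)) ξ
      = (-2 * Real.pi * Complex.I) * 𝓕 (fun v => ((v * sechKernel v : ℝ) : ℂ)) ξ := by
    rw [fourier_eq_integral_freq, fourier_eq_integral_freq, ← integral_const_mul]
    refine integral_congr_ae (Eventually.of_forall fun v => ?_)
    simp only [smul_eq_mul, Complex.ofReal_mul]
    ring
  have hne : -2 * Real.pi * Complex.I ≠ 0 := by simp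
  refine mul_left_cancel₀ hne (h3.symm.trans ((h1.unique h2).trans ?_))
  push_cast
  linear_combination (2 * Real.pi ^ 3 * Complex.sinh (Real.pi * freq ξ) /
    Complex.cosh (Real.pi * freq ξ) ^ 2) * Complex.I_mul_I

lemma abs_cschKernel_mul_sin_le (τ v : ℝ) :
    |cschKernel v * Real.sin (τ * v)| ≤ |τ| * logKernel v := by
  have h : |Real.sin (τ * v)| ≤ |τ| * |v| := (abs_mul τ v) ▸ Real.abs_sin_le_abs
  rw [abs_mul, logKernel_eq_abs_mul_abs, ← mul_assoc, mul_comm]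
  exact mul_le_mul_of_nonneg_right h (abs_nonneg _)

lemma integrable_cschKernel_mul_sin (τ : ℝ) :
    Integrable fun v => cschKernel v * Real.sin (τ * v) :=
  (integrable_logKernel.const_mul |τ|).mono'
    (measurable_cschKernel.mul (by fun_prop)).aestronglyMeasurable
    (Eventually.of_forall (abs_cschKernel_mul_sin_le τ))

lemma integral_logKernel_mul_cos (τ : ℝ) :
    ∫ v, logKernel v * Real.cos (τ * v) = (Real.pi / Real.cosh (Real.pi * τ)) ^ 2 := by
  have hfreq : freq (τ / (-(2 * Real.pi))) = τ := by rw [freq]; field_simp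
  have h := congrArg Complex.re (fourier_logKernel (τ / (-(2 * Real.pi))))
  rw [fourier_eq_integral_freq, hfreq, Complex.ofReal_re, ← RCLike.re_eq_complex_re,
    ← integral_re] at h
  · simpa [← Complex.ofReal_mul, Complex.exp_ofReal_mul_I_re] using h
  · refine integrable_logKernel.ofReal.mul_bdd (c := 1) ?_ (Eventually.of_forall fun v => ?_)
    · exact Continuous.aestronglyMeasurable (by fun_prop)
    · rw [← Complex.ofReal_mul, Complex.norm_exp_ofReal_mul_I]

lemma hasDerivAt_pi_mul_tanh_pi_mul (τ : ℝ) :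
    HasDerivAt (fun t => Real.pi * Real.tanh (Real.pi * t))
      ((Real.pi / Real.cosh (Real.pi * τ)) ^ 2) τ := by
  have h0 := (hasDerivAt_id τ).const_mul Real.pi
  simp only [Real.tanh_eq_sinh_div_cosh]
  refine ((h0.sinh.div h0.cosh (Real.cosh_pos _).ne').const_mul Real.pi).congr_deriv ?_
  have hcosh := (Real.cosh_pos (Real.pi * τ)).ne'
  simp only [id]
  field_simp
  linear_combination Real.cosh_sq (Real.pi * τ)

lemma hasDerivAt_integral_cschKernel_mul_sin (τ : ℝ) :
    HasDerivAt (fun t => ∫ v, cschKernel v * Real.sin (t * v))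
      ((Real.pi / Real.cosh (Real.pi * τ)) ^ 2) τ := by
  rw [← integral_logKernel_mul_cos]
  refine (hasDerivAt_integral_of_dominated_loc_of_deriv_le (s := univ) (bound := logKernel)
    (F' := fun t v => logKernel v * Real.cos (t * v)) univ_mem
    (Eventually.of_forall fun t => (integrable_cschKernel_mul_sin t).1)
    (integrable_cschKernel_mul_sin τ) (measurable_logKernel.mul (by fun_prop)).aestronglyMeasurable
    (Eventually.of_forall fun v t _ => ?_) integrable_logKernel
    (Eventually.of_forall fun v t _ => ?_)).2
  · rw [norm_mul, Real.norm_of_nonneg (logKernel_nonneg v)]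
    exact mul_le_of_le_one_right (logKernel_nonneg v) (Real.abs_cos_le_one _)
  · refine ((((hasDerivAt_id t).mul_const v).sin).const_mul (cschKernel v)).congr_deriv ?_
    simp only [id, logKernel]
    ring

lemma integral_cschKernel_mul_sin (τ : ℝ) :
    ∫ v, cschKernel v * Real.sin (τ * v) = Real.pi * Real.tanh (Real.pi * τ) := by
  have hz (t : ℝ) :=
    (hasDerivAt_integral_cschKernel_mul_sin t).sub (hasDerivAt_pi_mul_tanh_pi_mul t)
  simp only [sub_self] at hz
  have h := is_const_of_deriv_eq_zero (fun t => (hz t).differentiableAt) (fun t => (hz t).deriv) τ 0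
  simpa [sub_eq_zero] using h

/-! ### Lebesgue points and the Poisson kernel -/

section LebesguePoint

variable {F : Type*} [NormedAddCommGroup F] {m : ℝ → F} {u C : ℝ}

/-- `u` is a Lebesgue point of `m`, in the strong sense that involves the value `m u`. -/
def IsLebesguePoint (m : ℝ → F) (u : ℝ) : Prop :=
  Tendsto (fun r => ⨍ w in Metric.closedBall u r, ‖m w - m u‖) (𝓝[>] 0) (𝓝 0)

lemma ae_isLebesguePoint (hm : LocallyIntegrable m) : ∀ᵐ u, IsLebesguePoint m u := by
  filter_upwards [IsUnifLocDoublingMeasure.ae_tendsto_average_norm_sub volume hm 1] with u hu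
  refine hu (fun _ => u) (fun r => r) tendsto_id ?_
  filter_upwards [self_mem_nhdsWithin] with r (hr : 0 < r)
  simp [hr.le]

/-- The Poisson kernel of the upper half-plane, normalized to have integral `π`. -/
def poisson (η v : ℝ) : ℝ := η / (η ^ 2 + v ^ 2)

variable {η : ℝ}

lemma poisson_nonneg (hη : 0 < η) (v : ℝ) : 0 ≤ poisson η v := by
  unfold poisson; positivity

lemma poisson_le_inv (hη : 0 < η) (v : ℝ) : poisson η v ≤ 1 / η := by
  unfold poisson
  rw [div_le_div_iff₀ (by positivity) hη]
  nlinarith only [sq_nonneg v]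

lemma poisson_eq_inv_one_add_sq (hη : 0 < η) (v : ℝ) :
    poisson η v = 1 / η * (1 + (v / η) ^ 2)⁻¹ := by
  unfold poisson
  field_simp

lemma integrable_poisson (hη : 0 < η) : Integrable (poisson η) := by
  rw [funext (poisson_eq_inv_one_add_sq hη)]
  exact (integrable_inv_one_add_sq.comp_div hη.ne').const_mul _

lemma integral_poisson (hη : 0 < η) : ∫ v, poisson η v = Real.pi := by
  simp_rw [poisson_eq_inv_one_add_sq hη, integral_const_mul]
  rw [Measure.integral_comp_div (fun v => (1 + v ^ 2)⁻¹) η, integral_univ_inv_one_add_sq,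
    abs_of_pos hη, smul_eq_mul]
  field_simp

lemma exists_poisson_le (hη : 0 < η) (v : ℝ) :
    ∃ k : ℕ, |v| ≤ 2 ^ k * η ∧ poisson η v ≤ 4 * (1 / 4) ^ k / η := by
  classical
  have hex : ∃ k : ℕ, |v| ≤ 2 ^ k * η := by
    obtain ⟨k, hk⟩ := pow_unbounded_of_one_lt (|v| / η) one_lt_two
    exact ⟨k, ((div_lt_iff₀ hη).1 hk).le⟩
  refine ⟨Nat.find hex, Nat.find_spec hex, ?_⟩
  rcases hk : Nat.find hex with _ | k
  · exact (poisson_le_inv hη v).trans (by gcongr; norm_num)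
  · have hlt : 2 ^ k * η < |v| := not_le.1 (Nat.find_min hex (by omega))
    have hsq : 4 ^ k * η ^ 2 ≤ v ^ 2 := by
      calc (4 : ℝ) ^ k * η ^ 2 = (2 ^ k * η) ^ 2 := by
            rw [mul_pow, ← pow_mul, mul_comm k, pow_mul]; norm_num
        _ ≤ |v| ^ 2 := by gcongr
        _ = v ^ 2 := sq_abs v
    have hpow : (4 : ℝ) * (1 / 4) ^ (k + 1) = 1 / 4 ^ k := by
      rw [pow_succ, one_div_pow]; ring
    rw [hpow, poisson, div_div, div_le_div_iff₀ (by positivity) (by positivity)]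
    nlinarith only [hsq, sq_nonneg η]

/-- The mean oscillation of `m` around `m u` on the scale `r`, up to a factor `2`. -/
def oscillation (m : ℝ → F) (u r : ℝ) : ℝ :=
  1 / r * ∫ w in Metric.closedBall u r, ‖m w - m u‖

lemma oscillation_nonneg (m : ℝ → F) (u : ℝ) {r : ℝ} (hr : 0 < r) : 0 ≤ oscillation m u r :=
  mul_nonneg (by positivity) (integral_nonneg fun _ => norm_nonneg _)

lemma IsLebesguePoint.tendsto_oscillation (h : IsLebesguePoint m u) :
    Tendsto (oscillation m u) (𝓝[>] 0) (𝓝 0) := by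
  have h2 := Tendsto.const_mul (2 : ℝ) h
  rw [mul_zero] at h2
  refine h2.congr' ?_
  filter_upwards [self_mem_nhdsWithin] with r (hr : 0 < r)
  rw [setAverage_eq, Real.volume_real_closedBall hr.le, oscillation, smul_eq_mul]
  field_simp

lemma integrableOn_norm_sub_closedBall (hm : LocallyIntegrable m) (u r : ℝ) :
    IntegrableOn (fun w => ‖m w - m u‖) (Metric.closedBall u r) :=
  ((hm.integrableOn_isCompact (isCompact_closedBall u r)).sub
    (integrableOn_const (isCompact_closedBall u r).measure_lt_top.ne)).norm

lemma oscillation_le_of_memLp (hm : MemLp m 2) (u : ℝ) {r : ℝ} (hr : 0 < r) :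
    oscillation m u r ≤ (∫ w, ‖m w‖ ^ 2) / r + 2 * (1 + ‖m u‖) := by
  have hsq : Integrable fun w => ‖m w‖ ^ 2 := (memLp_two_iff_integrable_sq_norm hm.1).1 hm
  have hc : IntegrableOn (fun _ : ℝ => 1 + ‖m u‖) (Metric.closedBall u r) :=
    integrableOn_const (isCompact_closedBall u r).measure_lt_top.ne
  have hpt (w : ℝ) : ‖m w - m u‖ ≤ ‖m w‖ ^ 2 + (1 + ‖m u‖) := by
    nlinarith only [norm_sub_le (m w) (m u), sq_nonneg (‖m w‖ - 1), norm_nonneg (m w)]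
  calc oscillation m u r
      ≤ 1 / r * ∫ w in Metric.closedBall u r, (‖m w‖ ^ 2 + (1 + ‖m u‖)) := by
        refine mul_le_mul_of_nonneg_left (integral_mono ?_ (hsq.integrableOn.add hc) hpt)
          (by positivity)
        exact integrableOn_norm_sub_closedBall (hm.locallyIntegrable one_le_two) u r
    _ = 1 / r * ((∫ w in Metric.closedBall u r, ‖m w‖ ^ 2) + 2 * r * (1 + ‖m u‖)) := by
        rw [integral_add hsq.integrableOn hc, setIntegral_const,
          Real.volume_real_closedBall hr.le, smul_eq_mul]
    _ ≤ 1 / r * ((∫ w, ‖m w‖ ^ 2) + 2 * r * (1 + ‖m u‖)) := by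
        gcongr ?_ * (?_ + _)
        exact setIntegral_le_integral hsq (Eventually.of_forall fun w => by positivity)
    _ = _ := by field_simp

lemma IsLebesguePoint.exists_oscillation_le (h : IsLebesguePoint m u) (hm : MemLp m 2) :
    ∃ C : ℝ, ∀ r, 0 < r → oscillation m u r ≤ C := by
  obtain ⟨δ, hδ : 0 < δ, hsmall⟩ := mem_nhdsGT_iff_exists_Ioo_subset.1
    (h.tendsto_oscillation.eventually (gt_mem_nhds one_pos))
  refine ⟨max 1 ((∫ w, ‖m w‖ ^ 2) / δ + 2 * (1 + ‖m u‖)), fun r hr => ?_⟩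
  rcases lt_or_ge r δ with hrδ | hδr
  · exact (hsmall ⟨hr, hrδ⟩ : oscillation m u r < 1).le.trans (le_max_left _ _)
  · refine ((oscillation_le_of_memLp hm u hr).trans ?_).trans (le_max_right _ _)
    gcongr

/-- A majorant of `∫ poisson η (u - w) * ‖m w - m u‖` by oscillations over dyadic annuli. -/
def dyadicOscillation (m : ℝ → F) (u η : ℝ) : ℝ :=
  ∑' k : ℕ, 4 * (1 / 2) ^ k * oscillation m u (2 ^ k * η)

lemma dyadicOscillation_nonneg (m : ℝ → F) (u : ℝ) (hη : 0 < η) : 0 ≤ dyadicOscillation m u η :=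
  tsum_nonneg fun _ => mul_nonneg (by positivity) (oscillation_nonneg m u (by positivity))

lemma summable_four_mul_half_pow_mul (C : ℝ) :
    Summable fun k : ℕ => 4 * (1 / 2 : ℝ) ^ k * C :=
  (summable_geometric_two.mul_left 4).mul_right C

lemma IsLebesguePoint.tendsto_dyadicOscillation (h : IsLebesguePoint m u)
    (hC : ∀ r, 0 < r → oscillation m u r ≤ C) :
    Tendsto (dyadicOscillation m u) (𝓝[>] 0) (𝓝 0) := by
  have hscale (k : ℕ) : Tendsto (fun η : ℝ => 2 ^ k * η) (𝓝[>] 0) (𝓝[>] 0) := by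
    refine tendsto_nhdsWithin_iff.2 ⟨?_, ?_⟩
    · exact Continuous.tendsto' (by fun_prop) _ _ (mul_zero _) |>.mono_left nhdsWithin_le_nhds
    · filter_upwards [self_mem_nhdsWithin] with η (hη : 0 < η)
      exact mul_pos (by positivity) hη
  have key := tendsto_tsum_of_dominated_convergence
    (f := fun η (k : ℕ) => 4 * (1 / 2 : ℝ) ^ k * oscillation m u (2 ^ k * η))
    (summable_four_mul_half_pow_mul C)
    (fun k => (h.tendsto_oscillation.comp (hscale k)).const_mul (4 * (1 / 2 : ℝ) ^ k))
    (by
      filter_upwards [self_mem_nhdsWithin] with η (hη : 0 < η) k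
      have hpos : 0 < 2 ^ k * η := by positivity
      rw [Real.norm_of_nonneg (mul_nonneg (by positivity) (oscillation_nonneg m u hpos))]
      exact mul_le_mul_of_nonneg_left (hC _ hpos) (by positivity))
  simpa only [mul_zero, tsum_zero] using! key

lemma lintegral_poisson_mul_le (hm : LocallyIntegrable m)
    (hC : ∀ r, 0 < r → oscillation m u r ≤ C) (hη : 0 < η) :
    ∫⁻ w, ENNReal.ofReal (poisson η (u - w)) * ‖m w - m u‖ₑ
      ≤ ENNReal.ofReal (dyadicOscillation m u η) := by
  have hterm (k : ℕ) : 0 ≤ 4 * (1 / 2 : ℝ) ^ k * oscillation m u (2 ^ k * η) :=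
    mul_nonneg (by positivity) (oscillation_nonneg m u (by positivity))
  have hsum : Summable fun k : ℕ => 4 * (1 / 2 : ℝ) ^ k * oscillation m u (2 ^ k * η) :=
    (summable_four_mul_half_pow_mul C).of_nonneg_of_le hterm fun k =>
      mul_le_mul_of_nonneg_left (hC _ (by positivity)) (by positivity)
  have hmeas : AEMeasurable (fun w => ‖m w - m u‖ₑ) volume :=
    (hm.aestronglyMeasurable.sub aestronglyMeasurable_const).enorm
  have hball (k : ℕ) : ∫⁻ w in Metric.closedBall u (2 ^ k * η), ‖m w - m u‖ₑ
      = ENNReal.ofReal (∫ w in Metric.closedBall u (2 ^ k * η), ‖m w - m u‖) := by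
    rw [ofReal_integral_eq_lintegral_ofReal (integrableOn_norm_sub_closedBall hm u _)
      (Eventually.of_forall fun _ => norm_nonneg _)]
    simp_rw [ofReal_norm]
  rw [dyadicOscillation, ENNReal.ofReal_tsum_of_nonneg hterm hsum]
  calc ∫⁻ w, ENNReal.ofReal (poisson η (u - w)) * ‖m w - m u‖ₑ
      ≤ ∫⁻ w, ∑' k : ℕ, ENNReal.ofReal (4 * (1 / 4) ^ k / η) *
          (Metric.closedBall u (2 ^ k * η)).indicator (fun w => ‖m w - m u‖ₑ) w := by
        refine lintegral_mono fun w => ?_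
        obtain ⟨k, hk, hpoisson⟩ := exists_poisson_le hη (u - w)
        refine le_trans ?_ (ENNReal.le_tsum k)
        rw [indicator_of_mem (by rwa [mem_closedBall_iff_norm', Real.norm_eq_abs])]
        gcongr
    _ = ∑' k : ℕ, ∫⁻ w, ENNReal.ofReal (4 * (1 / 4) ^ k / η) *
          (Metric.closedBall u (2 ^ k * η)).indicator (fun w => ‖m w - m u‖ₑ) w :=
        lintegral_tsum fun k => (hmeas.indicator measurableSet_closedBall).const_mul _
    _ = ∑' k : ℕ, ENNReal.ofReal (4 * (1 / 2) ^ k * oscillation m u (2 ^ k * η)) := by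
        refine tsum_congr fun k => ?_
        rw [lintegral_const_mul' _ _ ENNReal.ofReal_ne_top,
          lintegral_indicator measurableSet_closedBall, hball, ← ENNReal.ofReal_mul (by positivity),
          oscillation, show ((1 : ℝ) / 2) ^ k = (1 / 4) ^ k * 2 ^ k by rw [← mul_pow]; norm_num]
        congr 1
        field_simp

lemma norm_integral_smul_sub_le [NormedSpace ℝ F] (hm : LocallyIntegrable m)
    (hC : ∀ r, 0 < r → oscillation m u r ≤ C) (hη : 0 < η) {d : ℝ → ℝ} {A : ℝ} (hA : 0 ≤ A)
    (hd : ∀ v, |d v| ≤ A * poisson η v) :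
    ‖∫ w, d (u - w) • (m w - m u)‖ ≤ A * dyadicOscillation m u η := by
  rw [← ENNReal.ofReal_le_ofReal_iff (mul_nonneg hA (dyadicOscillation_nonneg m u hη)), ofReal_norm]
  calc ‖∫ w, d (u - w) • (m w - m u)‖ₑ
      ≤ ∫⁻ w, ‖d (u - w) • (m w - m u)‖ₑ := enorm_integral_le_lintegral_enorm _
    _ ≤ ∫⁻ w, ENNReal.ofReal A * (ENNReal.ofReal (poisson η (u - w)) * ‖m w - m u‖ₑ) := by
        refine lintegral_mono fun w => ?_
        rw [enorm_smul, ← mul_assoc, ← ENNReal.ofReal_mul hA, ← ofReal_norm (d _)]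
        gcongr
        exact hd _
    _ = ENNReal.ofReal A * ∫⁻ w, ENNReal.ofReal (poisson η (u - w)) * ‖m w - m u‖ₑ :=
        lintegral_const_mul' _ _ ENNReal.ofReal_ne_top
    _ ≤ ENNReal.ofReal (A * dyadicOscillation m u η) := by
        rw [ENNReal.ofReal_mul hA]
        gcongr
        exact lintegral_poisson_mul_le hm hC hη

lemma integrable_of_le_poisson (hη : 0 < η) {d : ℝ → ℝ} {A : ℝ}
    (hdm : AEStronglyMeasurable d volume) (hd : ∀ v, |d v| ≤ A * poisson η v) : Integrable d :=
  ((integrable_poisson hη).const_mul A).mono' hdm (Eventually.of_forall hd)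

lemma memLp_two_of_le_poisson (hη : 0 < η) {d : ℝ → ℝ} {A : ℝ} (hA : 0 ≤ A)
    (hdm : AEStronglyMeasurable d volume) (hd : ∀ v, |d v| ≤ A * poisson η v) : MemLp d 2 :=
  memLp_two_of_integrable_of_norm_le (integrable_of_le_poisson hη hdm hd) (C := A * (1 / η))
    fun v => (hd v).trans (mul_le_mul_of_nonneg_left (poisson_le_inv hη v) hA)

lemma integrable_smul_comp_sub {𝕜 : Type*} [RCLike 𝕜] [NormedSpace 𝕜 F] {κ : ℝ → 𝕜}
    (hκ : MemLp κ 2) (hm : MemLp m 2) (u : ℝ) : Integrable fun w => κ (u - w) • m w :=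
  memLp_one_iff_integrable.1
    (hm.smul (hκ.comp_measurePreserving (Measure.measurePreserving_sub_left volume u)))

theorem IsLebesguePoint.tendsto_integral_smul_of_le_poisson [NormedSpace ℝ F] [CompleteSpace F]
    (h : IsLebesguePoint m u) (hm : MemLp m 2) {d : ℝ → ℝ → ℝ} {A c : ℝ} (hA : 0 ≤ A)
    (hdm : ∀ᶠ η in 𝓝[>] 0, AEStronglyMeasurable (d η) volume)
    (hd : ∀ᶠ η in 𝓝[>] 0, ∀ v, |d η v| ≤ A * poisson η v)
    (hc : Tendsto (fun η => ∫ v, d η v) (𝓝[>] 0) (𝓝 c)) :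
    Tendsto (fun η => ∫ w, d η (u - w) • m w) (𝓝[>] 0) (𝓝 (c • m u)) := by
  obtain ⟨C, hC⟩ := h.exists_oscillation_le hm
  have hosc : Tendsto (fun η => ∫ w, d η (u - w) • (m w - m u)) (𝓝[>] 0) (𝓝 0) := by
    refine squeeze_zero_norm' ?_ (mul_zero A ▸ (h.tendsto_dyadicOscillation hC).const_mul A)
    filter_upwards [hd, self_mem_nhdsWithin] with η hη hη0
    exact norm_integral_smul_sub_le (hm.locallyIntegrable one_le_two) hC hη0 hA hη
  have hlim := hosc.add (hc.smul_const (m u))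
  rw [zero_add] at hlim
  refine hlim.congr' ?_
  filter_upwards [hdm, hd, self_mem_nhdsWithin] with η hdη hη hη0
  have hint : Integrable fun w => d η (u - w) • m u :=
    ((integrable_of_le_poisson hη0 hdη hη).comp_sub_left u).smul_const _
  have hint' := integrable_smul_comp_sub (memLp_two_of_le_poisson hη0 hA hdη hη) hm u
  simp_rw [smul_sub]
  rw [integral_sub hint' hint, integral_smul_const, integral_sub_left_eq_self (d η) volume u,
    sub_add_cancel]

end LebesguePoint

/-! ### The Hilbert transform -/

section Hilbert

variable {η : ℝ} {m M H : ℝ → ℂ}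

/-- The conjugate Poisson kernel, normalized like `poisson`; it regularizes `1 / v`. -/
def conjPoisson (η v : ℝ) : ℝ := v / (η ^ 2 + v ^ 2)

/-- The Fourier multiplier `-iπ sgn ξ` of the principal value convolution with `1 / v`. -/
def hilbertMultiplier (ξ : ℝ) : ℂ := -(Real.pi * Real.sign ξ : ℝ) * Complex.I

lemma conjPoisson_neg (η v : ℝ) : conjPoisson η (-v) = -conjPoisson η v := by
  rw [conjPoisson, conjPoisson, neg_sq, neg_div]

lemma poisson_neg (η v : ℝ) : poisson η (-v) = poisson η v := by
  rw [poisson, poisson, neg_sq]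

lemma measurable_conjPoisson (η : ℝ) : Measurable (conjPoisson η) := by
  unfold conjPoisson; fun_prop

lemma norm_hilbertMultiplier_le (ξ : ℝ) : ‖hilbertMultiplier ξ‖ ≤ Real.pi := by
  rw [hilbertMultiplier, norm_mul, norm_neg, Complex.norm_I, mul_one, Complex.norm_real, norm_mul,
    Real.norm_of_nonneg Real.pi_pos.le]
  refine mul_le_of_le_one_right Real.pi_pos.le ?_
  rcases Real.sign_apply_eq ξ with h | h | h <;> simp [h]

lemma measurable_hilbertMultiplier : Measurable hilbertMultiplier := by
  have hsign : Measurable Real.sign :=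
    .ite measurableSet_Iio measurable_const
      (.ite measurableSet_Ioi measurable_const measurable_const)
  unfold hilbertMultiplier
  fun_prop

lemma memLp_top_hilbertMultiplier : MemLp hilbertMultiplier ∞ :=
  memLp_top_of_bound measurable_hilbertMultiplier.aestronglyMeasurable Real.pi
    (Eventually.of_forall norm_hilbertMultiplier_le)

lemma fourierInv_indicator_exp (hη : 0 < η) (v : ℝ) :
    𝓕⁻ ((Ioi (0 : ℝ)).indicator fun ξ =>
        ((2 * Real.pi * Real.exp (-(2 * Real.pi * η) * ξ) : ℝ) : ℂ)) v
      = poisson η v + conjPoisson η v * Complex.I := by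
  have hre : (2 * Real.pi * (v * Complex.I - η)).re < 0 := by
    simpa using mul_pos Real.two_pi_pos hη
  have hne : (v * Complex.I - η : ℂ) ≠ 0 := fun h => by simp [h] at hre
  have hne' : (η ^ 2 + v ^ 2 : ℂ) ≠ 0 := by
    exact_mod_cast (by positivity : η ^ 2 + v ^ 2 ≠ 0)
  calc 𝓕⁻ ((Ioi (0 : ℝ)).indicator fun ξ =>
        ((2 * Real.pi * Real.exp (-(2 * Real.pi * η) * ξ) : ℝ) : ℂ)) v
      = ∫ ξ in Ioi (0 : ℝ), 2 * Real.pi * Complex.exp (2 * Real.pi * (v * Complex.I - η) * ξ) := by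
        rw [Real.fourierInv_eq', ← integral_indicator measurableSet_Ioi]
        refine integral_congr_ae (Eventually.of_forall fun ξ => ?_)
        by_cases hξ : ξ ∈ Ioi (0 : ℝ)
        · simp only [indicator_of_mem hξ, RCLike.inner_apply, conj_trivial, smul_eq_mul]
          push_cast
          rw [mul_left_comm, ← Complex.exp_add]
          ring_nf
        · simp only [indicator_of_notMem hξ, smul_zero]
    _ = poisson η v + conjPoisson η v * Complex.I := by
        rw [integral_const_mul, integral_exp_mul_complex_Ioi hre, poisson, conjPoisson]
        push_cast
        rw [mul_zero, Complex.exp_zero]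
        field_simp
        linear_combination (-v ^ 2 : ℂ) * Complex.I_sq

lemma isFourierPair_poisson_add_conjPoisson (hη : 0 < η) :
    IsFourierPair (fun v => (poisson η v + conjPoisson η v * Complex.I : ℂ))
      ((Ioi (0 : ℝ)).indicator fun ξ =>
        ((2 * Real.pi * Real.exp (-(2 * Real.pi * η) * ξ) : ℝ) : ℂ)) := by
  have hη' : 0 < 2 * Real.pi * η := by positivity
  have hint : Integrable ((Ioi (0 : ℝ)).indicator fun ξ =>
      ((2 * Real.pi * Real.exp (-(2 * Real.pi * η) * ξ) : ℝ) : ℂ)) :=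
    (integrable_indicator_iff measurableSet_Ioi).2
      ((exp_neg_integrableOn_Ioi 0 hη').const_mul (2 * Real.pi)).ofReal
  rw [← funext (fourierInv_indicator_exp hη)]
  refine isFourierPair_fourierInv hint
    (memLp_two_of_integrable_of_norm_le hint (C := 2 * Real.pi) fun ξ => ?_)
  rw [norm_indicator_eq_indicator_norm]
  refine indicator_apply_le' (fun hξ => ?_) fun _ => by positivity
  rw [Complex.norm_real, Real.norm_of_nonneg (by positivity)]
  refine mul_le_of_le_one_right (by positivity) (Real.exp_le_one_iff.2 ?_)
  nlinarith only [mul_pos hη' (mem_Ioi.1 hξ)]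

lemma isFourierPair_poisson (hη : 0 < η) :
    IsFourierPair (fun v => (poisson η v : ℂ))
      (fun ξ => ((Real.pi * Real.exp (-(2 * Real.pi * η) * |ξ|) : ℝ) : ℂ)) := by
  have h := isFourierPair_poisson_add_conjPoisson hη
  refine (((h.add h.comp_neg).const_smul (1 / 2)).congr_left
    (.of_forall fun v => ?_)).congr_right ?_
  · simp only [Pi.smul_apply, Pi.add_apply, conjPoisson_neg, poisson_neg, smul_eq_mul]
    push_cast
    ring
  · filter_upwards [volume.ae_ne (0 : ℝ)] with ξ hξ
    rcases hξ.lt_or_gt with h0 | h0 <;>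
      simp [indicator, h0, h0.not_gt, abs_of_neg, abs_of_pos] <;> ring

lemma isFourierPair_conjPoisson (hη : 0 < η) :
    IsFourierPair (fun v => (conjPoisson η v : ℂ))
      (fun ξ => hilbertMultiplier ξ * Real.exp (-(2 * Real.pi * η) * |ξ|)) := by
  have h := isFourierPair_poisson_add_conjPoisson hη
  refine (((h.sub h.comp_neg).const_smul (-Complex.I / 2)).congr_left
    (.of_forall fun v => ?_)).congr_right ?_
  · simp only [Pi.smul_apply, Pi.sub_apply, conjPoisson_neg, poisson_neg, smul_eq_mul]
    push_cast
    linear_combination (-conjPoisson η v : ℂ) * Complex.I_sq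
  · filter_upwards [volume.ae_ne (0 : ℝ)] with ξ hξ
    rcases hξ.lt_or_gt with h0 | h0 <;>
      simp [indicator, h0, h0.not_gt, abs_of_neg, abs_of_pos, hilbertMultiplier,
        Real.sign_of_neg, Real.sign_of_pos] <;> ring

lemma integral_conjPoisson_mul (hm : IsFourierPair m M)
    (hH : IsFourierPair H (fun ξ => hilbertMultiplier ξ * M ξ)) (hη : 0 < η) (u : ℝ) :
    ∫ w, (conjPoisson η (u - w) : ℂ) * m w
      = (Real.pi : ℂ)⁻¹ * ∫ w, (poisson η (u - w) : ℂ) * H w := by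
  rw [(isFourierPair_conjPoisson hη).integral_kernel_mul hm,
    (isFourierPair_poisson hη).integral_kernel_mul hH, Real.fourierInv_eq, Real.fourierInv_eq,
    ← integral_const_mul]
  refine integral_congr_ae (.of_forall fun ξ => ?_)
  simp only [Circle.smul_def, smul_eq_mul]
  have hπ : (Real.pi : ℂ) ≠ 0 := by exact_mod_cast Real.pi_ne_zero
  push_cast
  field_simp

end Hilbert

lemma integral_eq_zero_of_odd {E : Type*} [NormedAddCommGroup E] [NormedSpace ℝ E] {f : ℝ → E}
    (hf : Function.Odd f) : ∫ v, f v = 0 := by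
  have h := integral_neg_eq_self f volume
  simp_rw [hf _, integral_neg] at h
  have := IsAddTorsionFree.of_isTorsionFree ℝ E
  exact self_eq_neg.1 h.symm

/-- The points `v = u - w` for which `t = e^w` has distance larger than `ε e^u` from `e^u`. -/
def cutSet (ε : ℝ) : Set ℝ := Ioi (-Real.log (1 - ε)) ∪ Iio (-Real.log (1 + ε))

/-- The points by which `cutSet ε` fails to be symmetric. -/
def strip (ε : ℝ) : Set ℝ := Ico (Real.log (1 - ε)) (-Real.log (1 + ε))

section cutSet

variable {ε v : ℝ}

lemma measurableSet_cutSet (ε : ℝ) : MeasurableSet (cutSet ε) :=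
  measurableSet_Ioi.union measurableSet_Iio

lemma measurableSet_strip (ε : ℝ) : MeasurableSet (strip ε) := measurableSet_Ico

lemma eventually_mem_cutSet (hv : v ≠ 0) : ∀ᶠ ε in 𝓝[>] (0 : ℝ), v ∈ cutSet ε := by
  have hright : Tendsto (fun ε : ℝ => -Real.log (1 - ε)) (𝓝[>] 0) (𝓝 0) := by
    have h : ContinuousAt (fun ε : ℝ => -Real.log (1 - ε)) 0 := by fun_prop (disch := norm_num)
    simpa using h.tendsto.mono_left nhdsWithin_le_nhds
  have hleft : Tendsto (fun ε : ℝ => -Real.log (1 + ε)) (𝓝[>] 0) (𝓝 0) := by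
    have h : ContinuousAt (fun ε : ℝ => -Real.log (1 + ε)) 0 := by fun_prop (disch := norm_num)
    simpa using h.tendsto.mono_left nhdsWithin_le_nhds
  rcases lt_or_gt_of_ne hv with h | h
  · filter_upwards [hleft.eventually (lt_mem_nhds h)] with ε hε using Or.inr hε
  · filter_upwards [hright.eventually (gt_mem_nhds h)] with ε hε using Or.inl hε

lemma measurable_indicator_cutSet_inv_sub_conjPoisson (ε : ℝ) :
    Measurable fun v => (cutSet ε).indicator (·⁻¹) v - conjPoisson ε v :=
  (measurable_inv.indicator (measurableSet_cutSet ε)).sub (measurable_conjPoisson ε)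

variable (h0 : 0 < ε) (h1 : ε ≤ 1 / 2)

include h0 h1

lemma half_le_log_one_add : ε / 2 ≤ Real.log (1 + ε) := by
  refine le_trans ?_ (Real.one_sub_inv_le_log_of_pos (by linarith))
  rw [inv_eq_one_div, one_sub_div (by linarith), add_sub_cancel_left]
  exact div_le_div_of_nonneg_left h0.le (by linarith) (by linarith)

lemma log_one_add_le_neg_log_one_sub : Real.log (1 + ε) ≤ -Real.log (1 - ε) := by
  linarith [Real.log_le_sub_one_of_pos (x := 1 - ε) (by linarith),
    Real.log_le_sub_one_of_pos (x := 1 + ε) (by linarith)]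

lemma neg_log_one_sub_sub_log_one_add_le :
    -Real.log (1 - ε) - Real.log (1 + ε) ≤ 2 * ε ^ 2 := by
  have hp : 0 < 1 - ε ^ 2 := by nlinarith only [h0, h1]
  have hlog : Real.log (1 - ε ^ 2) = Real.log (1 - ε) + Real.log (1 + ε) := by
    rw [← Real.log_mul (by linarith) (by linarith)]; ring_nf
  have hinv : (1 - ε ^ 2)⁻¹ ≤ 1 + 2 * ε ^ 2 := by
    rw [inv_le_iff_one_le_mul₀ hp]
    nlinarith only [mul_nonneg (sq_nonneg ε) (by nlinarith only [h0, h1] : 0 ≤ 1 - 2 * ε ^ 2)]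
  linarith [Real.one_sub_inv_le_log_of_pos hp]

lemma neg_log_one_sub_le : -Real.log (1 - ε) ≤ 2 * ε := by
  nlinarith only [neg_log_one_sub_sub_log_one_add_le h0 h1, h0, h1,
    Real.log_le_sub_one_of_pos (x := 1 + ε) (by linarith)]

lemma half_le_abs_of_mem_cutSet (hv : v ∈ cutSet ε) : ε / 2 ≤ |v| := by
  have hb := half_le_log_one_add h0 h1
  have hab := log_one_add_le_neg_log_one_sub h0 h1
  rcases hv with hv | hv
  · exact (hb.trans (hab.trans (mem_Ioi.1 hv).le)).trans (le_abs_self v)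
  · exact (hb.trans (le_neg_of_le_neg (mem_Iio.1 hv).le)).trans (neg_le_abs v)

lemma abs_le_of_notMem_cutSet (hv : v ∉ cutSet ε) : |v| ≤ 2 * ε := by
  have ha := neg_log_one_sub_le h0 h1
  have hab := log_one_add_le_neg_log_one_sub h0 h1
  simp only [cutSet, mem_union, mem_Ioi, mem_Iio, not_or, not_lt] at hv
  exact abs_le.2 ⟨by linarith, by linarith⟩

lemma indicator_cutSet_eq_add {E : Type*} [AddZeroClass E] (f : ℝ → E) :
    (cutSet ε).indicator f
      = {v | -Real.log (1 - ε) < |v|}.indicator f + (strip ε).indicator f := by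
  have hb := half_le_log_one_add h0 h1
  have hab := log_one_add_le_neg_log_one_sub h0 h1
  have hunion : cutSet ε = {v | -Real.log (1 - ε) < |v|} ∪ strip ε := by
    ext v
    simp only [cutSet, strip, mem_union, mem_Ioi, mem_Iio, mem_ofPred_eq, mem_Ico, lt_abs]
    grind
  have hdisj : Disjoint {v | -Real.log (1 - ε) < |v|} (strip ε) := by
    refine Set.disjoint_left.2 fun v hv hv' => ?_
    rcases lt_abs.1 (mem_ofPred_eq ▸ hv) with hv | hv <;> linarith [hv'.1, hv'.2]
  rw [hunion, indicator_union_of_disjoint hdisj]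
  rfl

lemma norm_setIntegral_strip_inv_le : ‖∫ v in strip ε, v⁻¹‖ ≤ 4 * ε := by
  have hb := half_le_log_one_add h0 h1
  have hab := log_one_add_le_neg_log_one_sub h0 h1
  have hlen := neg_log_one_sub_sub_log_one_add_le h0 h1
  have hbound (v : ℝ) (hv : v ∈ strip ε) : ‖v⁻¹‖ ≤ 2 / ε := by
    rw [norm_inv, Real.norm_eq_abs, ← inv_div ε 2]
    exact inv_anti₀ (by positivity) ((hb.trans (le_neg_of_le_neg hv.2.le)).trans (neg_le_abs v))
  calc ‖∫ v in strip ε, v⁻¹‖ ≤ 2 / ε * volume.real (strip ε) :=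
        norm_setIntegral_le_of_norm_le_const measure_Ico_lt_top hbound
    _ = 2 / ε * (-Real.log (1 - ε) - Real.log (1 + ε)) := by
        rw [strip, Real.volume_real_Ico_of_le (by linarith)]
        ring
    _ ≤ 2 / ε * (2 * ε ^ 2) := by gcongr
    _ = 4 * ε := by field_simp; norm_num

lemma abs_indicator_cutSet_inv_sub_conjPoisson_le (v : ℝ) :
    |(cutSet ε).indicator (·⁻¹) v - conjPoisson ε v| ≤ 2 * poisson ε v := by
  by_cases hv : v ∈ cutSet ε
  · have hle := half_le_abs_of_mem_cutSet h0 h1 hv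
    have hpos : 0 < |v| := (half_pos h0).trans_le hle
    have hv0 : v ≠ 0 := abs_pos.1 hpos
    calc |(cutSet ε).indicator (·⁻¹) v - conjPoisson ε v| = |ε / v * poisson ε v| := by
          rw [indicator_of_mem hv, conjPoisson, poisson]
          congr 1
          field_simp
          ring
      _ = ε / |v| * poisson ε v := by
          rw [abs_mul, abs_div, abs_of_pos h0, abs_of_nonneg (poisson_nonneg h0 v)]
      _ ≤ 2 * poisson ε v := by
          refine mul_le_mul_of_nonneg_right ?_ (poisson_nonneg h0 v)
          rw [div_le_iff₀ hpos]
          linarith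
  · have hle := abs_le_of_notMem_cutSet h0 h1 hv
    rw [indicator_of_notMem hv, zero_sub, abs_neg, conjPoisson, poisson, abs_div,
      abs_of_pos (by positivity : 0 < ε ^ 2 + v ^ 2), ← mul_div_assoc]
    gcongr

lemma norm_integral_indicator_cutSet_inv_sub_conjPoisson_le :
    ‖∫ v, ((cutSet ε).indicator (·⁻¹) v - conjPoisson ε v)‖ ≤ 4 * ε := by
  have hb := half_le_log_one_add h0 h1
  have hstrip : Integrable ((strip ε).indicator (·⁻¹)) := by
    refine (integrable_indicator_iff (measurableSet_strip ε)).2 ?_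
    refine (ContinuousOn.integrableOn_Icc fun v hv => ?_).mono_set Ico_subset_Icc_self
    exact (continuousAt_inv₀ (by linarith [hv.2] : v < 0).ne).continuousWithinAt
  have hint := integrable_of_le_poisson h0
    (measurable_indicator_cutSet_inv_sub_conjPoisson ε).aestronglyMeasurable
    (abs_indicator_cutSet_inv_sub_conjPoisson_le h0 h1)
  have hsymm : ∫ v, ((cutSet ε).indicator (·⁻¹) v - conjPoisson ε v
      - (strip ε).indicator (·⁻¹) v) = 0 := by
    refine integral_eq_zero_of_odd fun v => ?_
    simp only [congrFun (indicator_cutSet_eq_add h0 h1 (·⁻¹)) _, Pi.add_apply, conjPoisson_neg,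
      add_sub_right_comm]
    simp only [indicator, mem_ofPred_eq, abs_neg, inv_neg]
    split_ifs <;> ring
  rw [integral_sub hint hstrip, sub_eq_zero] at hsymm
  rw [hsymm, integral_indicator (measurableSet_strip ε)]
  exact norm_setIntegral_strip_inv_le h0 h1

end cutSet

lemma eventually_pos_and_le_half : ∀ᶠ ε in 𝓝[>] (0 : ℝ), 0 < ε ∧ ε ≤ 1 / 2 := by
  filter_upwards [Ioc_mem_nhdsGT (by norm_num : (0 : ℝ) < 1 / 2)] with ε hε using hε

lemma tendsto_integral_indicator_cutSet_inv_sub_conjPoisson :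
    Tendsto (fun ε => ∫ v, ((cutSet ε).indicator (·⁻¹) v - conjPoisson ε v)) (𝓝[>] 0) (𝓝 0) := by
  have h4 : Tendsto (fun ε : ℝ => 4 * ε) (𝓝[>] 0) (𝓝 0) :=
    (Continuous.tendsto' (by fun_prop) _ _ (mul_zero _)).mono_left nhdsWithin_le_nhds
  refine squeeze_zero_norm' ?_ h4
  filter_upwards [eventually_pos_and_le_half] with ε ⟨h0, h1⟩
  exact norm_integral_indicator_cutSet_inv_sub_conjPoisson_le h0 h1

lemma IsLebesguePoint.tendsto_integral_poisson_smul {F : Type*} [NormedAddCommGroup F]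
    [NormedSpace ℝ F] [CompleteSpace F] {m : ℝ → F} {u : ℝ} (h : IsLebesguePoint m u)
    (hm : MemLp m 2) :
    Tendsto (fun ε => ∫ w, poisson ε (u - w) • m w) (𝓝[>] 0) (𝓝 (Real.pi • m u)) := by
  refine h.tendsto_integral_smul_of_le_poisson hm zero_le_one ?_ ?_ ?_
  · filter_upwards [self_mem_nhdsWithin] with ε hε using (integrable_poisson hε).1
  · filter_upwards [self_mem_nhdsWithin] with ε hε v
    rw [one_mul, abs_of_nonneg (poisson_nonneg hε v)]
  · refine tendsto_const_nhds.congr' ?_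
    filter_upwards [self_mem_nhdsWithin] with ε hε using (integral_poisson hε).symm

lemma ae_tendsto_integral_indicator_cutSet_inv_mul {m M H : ℝ → ℂ} (hm : IsFourierPair m M)
    (hH : IsFourierPair H (fun ξ => hilbertMultiplier ξ * M ξ)) :
    ∀ᵐ u, Tendsto (fun ε => ∫ w, (((cutSet ε).indicator (·⁻¹) (u - w) : ℝ) : ℂ) * m w)
      (𝓝[>] 0) (𝓝 (H u)) := by
  have hm2 := hm.memLp_left
  have hH2 := hH.memLp_left
  filter_upwards [ae_isLebesguePoint (hm2.locallyIntegrable one_le_two),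
    ae_isLebesguePoint (hH2.locallyIntegrable one_le_two)] with u hmu hHu
  have hdiff : Tendsto (fun ε => ∫ w,
      ((cutSet ε).indicator (·⁻¹) (u - w) - conjPoisson ε (u - w)) • m w) (𝓝[>] 0) (𝓝 0) := by
    rw [← zero_smul ℝ (m u)]
    refine hmu.tendsto_integral_smul_of_le_poisson hm2
      (d := fun ε v => (cutSet ε).indicator (·⁻¹) v - conjPoisson ε v) zero_le_two
      (.of_forall fun ε =>
        (measurable_indicator_cutSet_inv_sub_conjPoisson ε).aestronglyMeasurable) ?_
      tendsto_integral_indicator_cutSet_inv_sub_conjPoisson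
    filter_upwards [eventually_pos_and_le_half] with ε ⟨h0, h1⟩
    exact abs_indicator_cutSet_inv_sub_conjPoisson_le h0 h1
  have hlim := hdiff.add
    ((hHu.tendsto_integral_poisson_smul hH2).const_mul (Real.pi : ℂ)⁻¹)
  rw [zero_add, Complex.real_smul, inv_mul_cancel_left₀ (by exact_mod_cast Real.pi_ne_zero)] at hlim
  refine hlim.congr' ?_
  filter_upwards [eventually_pos_and_le_half] with ε ⟨h0, h1⟩
  have hd := memLp_two_of_le_poisson h0 zero_le_two
    (measurable_indicator_cutSet_inv_sub_conjPoisson ε).aestronglyMeasurable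
    (abs_indicator_cutSet_inv_sub_conjPoisson_le h0 h1)
  simp_rw [Complex.real_smul, ← integral_conjPoisson_mul hm hH h0 u]
  rw [← integral_add]
  · refine integral_congr_ae (.of_forall fun w => ?_)
    push_cast
    ring
  · simpa only [Complex.real_smul] using integrable_smul_comp_sub hd hm2 u
  · exact integrable_smul_comp_sub (isFourierPair_conjPoisson h0).memLp_left hm2 u

/-! ### The Fourier multiplier of the singular kernel -/

section Multiplier

variable {ε : ℝ} {m M : ℝ → ℂ}

lemma sinh_le_mul_cosh {x : ℝ} (hx : 0 ≤ x) : Real.sinh x ≤ x * Real.cosh x := by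
  rcases hx.eq_or_lt with rfl | hx
  · simp
  obtain ⟨c, ⟨hc0, hcx⟩, hc⟩ := exists_hasDerivAt_eq_slope Real.sinh Real.cosh hx
    Real.continuous_sinh.continuousOn fun c _ => Real.hasDerivAt_sinh c
  rw [Real.sinh_zero, sub_zero, sub_zero, eq_div_iff hx.ne'] at hc
  rw [← hc, mul_comm]
  refine mul_le_mul_of_nonneg_left (Real.cosh_le_cosh.2 ?_) hx.le
  rw [abs_of_pos hc0, abs_of_pos hx]
  exact hcx.le

lemma one_sub_logKernel_le {v : ℝ} (hv : v ≠ 0) : 1 - logKernel v ≤ v ^ 2 / 8 := by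
  set x := |v| / 2 with hx_def
  have hx : 0 < x := half_pos (abs_pos.2 hv)
  have hlog : logKernel v = x / Real.sinh x := by
    rw [logKernel_eq_abs_mul_abs, abs_cschKernel, cschKernel, ← hx_def]
    ring
  have hsq : v ^ 2 / 8 = x ^ 2 / 2 := by rw [hx_def, div_pow, sq_abs]; ring
  rw [hlog, hsq, sub_le_comm]
  calc 1 - x ^ 2 / 2 ≤ Real.exp (-(x ^ 2 / 2)) := Real.one_sub_le_exp_neg _
    _ = 1 / Real.exp (x ^ 2 / 2) := by rw [Real.exp_neg, one_div]
    _ ≤ 1 / Real.cosh x := one_div_le_one_div_of_le (Real.cosh_pos x) (Real.cosh_le_exp_half_sq x)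
    _ ≤ x / Real.sinh x := by
      rw [div_le_div_iff₀ (Real.cosh_pos x) (Real.sinh_pos_iff.2 hx), one_mul]
      exact sinh_le_mul_cosh hx.le

/-- What remains of `cschKernel` after its singularity `1 / v` is removed. -/
def cschRemainder (v : ℝ) : ℝ := cschKernel v - v⁻¹

lemma measurable_cschRemainder : Measurable cschRemainder :=
  measurable_cschKernel.sub measurable_inv

lemma abs_cschRemainder_le (v : ℝ) : |cschRemainder v| ≤ 2 * |conjPoisson 1 v| := by
  rcases eq_or_ne v 0 with rfl | hv
  · simp [cschRemainder, cschKernel]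
  have hpos : 0 < |v| := abs_pos.2 hv
  have heq : |cschRemainder v| = (1 - logKernel v) / |v| := by
    rw [cschRemainder, show cschKernel v - v⁻¹ = -((1 - logKernel v) / v) by
      rw [logKernel]; field_simp; ring, abs_neg, abs_div,
      abs_of_nonneg (sub_nonneg.2 (logKernel_le_one v))]
  rw [heq, conjPoisson, abs_div, abs_of_pos (by positivity : 0 < 1 ^ 2 + v ^ 2), ← mul_div_assoc,
    div_le_div_iff₀ hpos (by positivity), mul_assoc, abs_mul_abs_self]
  nlinarith only [one_sub_logKernel_le hv, sq_nonneg v,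
    mul_nonneg (logKernel_nonneg v) (sq_nonneg v)]

lemma memLp_cschRemainder : MemLp (fun v => (cschRemainder v : ℂ)) 2 := by
  refine (isFourierPair_conjPoisson one_pos).memLp_left.of_le_mul (c := 2)
    (Complex.measurable_ofReal.comp measurable_cschRemainder).aestronglyMeasurable
    (.of_forall fun v => ?_)
  simpa only [Complex.norm_real, Real.norm_eq_abs] using abs_cschRemainder_le v

lemma logKernel_mul_conjPoisson_sub_conjPoisson (hε : 0 < ε) (v : ℝ) :
    logKernel v * conjPoisson ε v - conjPoisson ε v
      = cschRemainder v * (v ^ 2 / (ε ^ 2 + v ^ 2)) := by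
  rcases eq_or_ne v 0 with rfl | hv
  · simp [logKernel, conjPoisson]
  · rw [logKernel, conjPoisson, cschRemainder]
    field_simp

lemma tendsto_sq_div_sq_add_sq {ι : Type*} {l : Filter ι} {η : ι → ℝ} (hη : Tendsto η l (𝓝 0))
    {v : ℝ} (hv : v ≠ 0) : Tendsto (fun i => v ^ 2 / (η i ^ 2 + v ^ 2)) l (𝓝 1) := by
  have h := tendsto_const_nhds (x := v ^ 2).div ((hη.pow 2).add_const (v ^ 2)) (by simpa using hv)
  rwa [zero_pow two_ne_zero, zero_add, div_self (pow_ne_zero 2 hv)] at h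

lemma sq_div_sq_add_sq_le_one (a b : ℝ) : b ^ 2 / (a ^ 2 + b ^ 2) ≤ 1 :=
  div_le_one_of_le₀ (le_add_of_nonneg_left (sq_nonneg a)) (by positivity)

lemma abs_conjPoisson_le_inv (hε : 0 < ε) (v : ℝ) : |conjPoisson ε v| ≤ ε⁻¹ := by
  rw [conjPoisson, abs_div, abs_of_pos (by positivity : 0 < ε ^ 2 + v ^ 2),
    div_le_iff₀ (by positivity), le_inv_mul_iff₀ hε, ← sq_abs v]
  nlinarith only [sq_nonneg (ε - |v|), sq_nonneg ε, sq_nonneg |v|]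

lemma integrable_logKernel_mul_conjPoisson (hε : 0 < ε) :
    Integrable fun v => logKernel v * conjPoisson ε v :=
  integrable_logKernel.mul_bdd (c := ε⁻¹) (measurable_conjPoisson ε).aestronglyMeasurable
    (.of_forall (abs_conjPoisson_le_inv hε))

lemma fourier_ofReal_of_odd {f : ℝ → ℝ} (hf : Integrable f) (hodd : Function.Odd f) (ξ : ℝ) :
    𝓕 (fun v => (f v : ℂ)) ξ = (∫ v, f v * Real.sin (freq ξ * v) : ℝ) * Complex.I := by
  have hcos : Integrable fun v => f v * Real.cos (freq ξ * v) :=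
    hf.mul_bdd (c := 1) (by fun_prop) (.of_forall fun v => Real.abs_cos_le_one _)
  have hsin : Integrable fun v => f v * Real.sin (freq ξ * v) :=
    hf.mul_bdd (c := 1) (by fun_prop) (.of_forall fun v => Real.abs_sin_le_one _)
  have hzero : ∫ v, f v * Real.cos (freq ξ * v) = 0 :=
    integral_eq_zero_of_odd fun v => by rw [hodd, mul_neg, Real.cos_neg, neg_mul]
  calc 𝓕 (fun v => (f v : ℂ)) ξ
      = ∫ v, (((f v * Real.cos (freq ξ * v) : ℝ) : ℂ)
          + ((f v * Real.sin (freq ξ * v) : ℝ) : ℂ) * Complex.I) := by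
        rw [fourier_eq_integral_freq]
        refine integral_congr_ae (.of_forall fun v => ?_)
        dsimp only
        rw [← Complex.ofReal_mul, Complex.exp_mul_I, ← Complex.ofReal_cos, ← Complex.ofReal_sin]
        push_cast
        ring
    _ = (∫ v, f v * Real.sin (freq ξ * v) : ℝ) * Complex.I := by
        rw [integral_add hcos.ofReal (hsin.ofReal.mul_const _), integral_mul_const,
          integral_complex_ofReal, integral_complex_ofReal, hzero, Complex.ofReal_zero, zero_add]

lemma tendsto_integral_logKernel_mul_conjPoisson_mul_sin {ι : Type*} {l : Filter ι}
    [l.IsCountablyGenerated] {η : ι → ℝ} (hη : Tendsto η l (𝓝 0)) (τ : ℝ) :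
    Tendsto (fun i => ∫ v, logKernel v * conjPoisson (η i) v * Real.sin (τ * v)) l
      (𝓝 (Real.pi * Real.tanh (Real.pi * τ))) := by
  have heq (δ v : ℝ) : logKernel v * conjPoisson δ v * Real.sin (τ * v)
      = cschKernel v * Real.sin (τ * v) * (v ^ 2 / (δ ^ 2 + v ^ 2)) := by
    rw [logKernel, conjPoisson]; ring
  simp_rw [← integral_cschKernel_mul_sin, heq]
  refine tendsto_integral_filter_of_dominated_convergence
    (fun v => ‖cschKernel v * Real.sin (τ * v)‖) (.of_forall fun i => ?_)
    (.of_forall fun i => .of_forall fun v => ?_) (integrable_cschKernel_mul_sin τ).norm ?_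
  · exact (integrable_cschKernel_mul_sin τ).1.mul
      (by fun_prop : Measurable fun v : ℝ => v ^ 2 / (η i ^ 2 + v ^ 2)).aestronglyMeasurable
  · rw [norm_mul]
    refine mul_le_of_le_one_right (norm_nonneg _) ?_
    rw [Real.norm_of_nonneg (by positivity)]
    exact sq_div_sq_add_sq_le_one (η i) v
  · filter_upwards [volume.ae_ne (0 : ℝ)] with v hv
    simpa using (tendsto_sq_div_sq_add_sq hη hv).const_mul (cschKernel v * Real.sin (τ * v))

lemma isFourierPair_logKernel_mul_conjPoisson_sub_conjPoisson (hε : 0 < ε) :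
    IsFourierPair (fun v => ((logKernel v * conjPoisson ε v - conjPoisson ε v : ℝ) : ℂ))
      (fun ξ => (∫ v, logKernel v * conjPoisson ε v * Real.sin (freq ξ * v) : ℝ) * Complex.I
        - hilbertMultiplier ξ * Real.exp (-(2 * Real.pi * ε) * |ξ|)) := by
  have hint := integrable_logKernel_mul_conjPoisson hε
  have hodd : Function.Odd fun v => logKernel v * conjPoisson ε v := fun v => by
    simp only [logKernel_neg, conjPoisson_neg, mul_neg]
  have hL2 : MemLp (fun v => ((logKernel v * conjPoisson ε v : ℝ) : ℂ)) 2 := by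
    refine memLp_two_of_integrable_of_norm_le hint.ofReal (C := ε⁻¹) fun v => ?_
    rw [Complex.norm_real, norm_mul, Real.norm_of_nonneg (logKernel_nonneg v)]
    exact (mul_le_of_le_one_left (norm_nonneg _) (logKernel_le_one v)).trans
      (abs_conjPoisson_le_inv hε v)
  refine (((isFourierPair_fourier hint.ofReal hL2).sub (isFourierPair_conjPoisson hε)).congr_left
    (.of_forall fun v => ?_)).congr_right (.of_forall fun ξ => ?_)
  · simp
  · simp only [Pi.sub_apply, fourier_ofReal_of_odd hint hodd]

theorem isFourierPair_cschRemainder :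
    IsFourierPair (fun v => (cschRemainder v : ℂ)) (fun ξ =>
      (Real.pi * Real.tanh (Real.pi * freq ξ) : ℝ) * Complex.I - hilbertMultiplier ξ) := by
  have hη : Tendsto (fun n : ℕ => 1 / ((n : ℝ) + 1)) atTop (𝓝 0) :=
    tendsto_one_div_add_atTop_nhds_zero_nat
  refine IsFourierPair.of_tendsto_ae (l := atTop) (fun n =>
    isFourierPair_logKernel_mul_conjPoisson_sub_conjPoisson (Nat.one_div_pos_of_nat (n := n)))
    memLp_cschRemainder ?_ (.of_forall fun ξ => ?_)
  · refine tendsto_eLpNorm_sub_of_dominated two_ne_zero ENNReal.ofNat_ne_top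
      memLp_cschRemainder.norm memLp_cschRemainder.1 (.of_forall fun n =>
        (isFourierPair_logKernel_mul_conjPoisson_sub_conjPoisson
          Nat.one_div_pos_of_nat).memLp_left.1) (.of_forall fun n => .of_forall fun v => ?_) ?_
    · rw [logKernel_mul_conjPoisson_sub_conjPoisson Nat.one_div_pos_of_nat, ← Complex.ofReal_sub,
        Complex.norm_real, Complex.norm_real, ← mul_sub_one, norm_mul]
      refine mul_le_of_le_one_right (norm_nonneg _) (abs_le.2 ⟨?_, ?_⟩)
      · linarith [show 0 ≤ v ^ 2 / ((1 / ((n : ℝ) + 1)) ^ 2 + v ^ 2) by positivity]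
      · linarith [sq_div_sq_add_sq_le_one (1 / ((n : ℝ) + 1)) v]
    · filter_upwards [volume.ae_ne (0 : ℝ)] with v hv
      simp_rw [logKernel_mul_conjPoisson_sub_conjPoisson Nat.one_div_pos_of_nat]
      simpa using (((tendsto_sq_div_sq_add_sq hη hv).const_mul (cschRemainder v)).ofReal :
        Tendsto _ _ (𝓝 ((_ : ℝ) : ℂ)))
  · have hsin := tendsto_integral_logKernel_mul_conjPoisson_mul_sin hη (freq ξ)
    have hexp : Tendsto (fun n : ℕ => Real.exp (-(2 * Real.pi * (1 / ((n : ℝ) + 1))) * |ξ|)) atTop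
        (𝓝 1) := by
      have h := ((hη.const_mul (2 * Real.pi)).neg.mul_const |ξ|).rexp
      rwa [mul_zero, neg_zero, zero_mul, Real.exp_zero] at h
    simpa using (hsin.ofReal.mul_const Complex.I).sub (hexp.ofReal.const_mul (hilbertMultiplier ξ))

lemma one_add_sinh_mul_I_mul (x : ℝ) :
    (1 + (Real.sinh x : ℂ) * Complex.I) * (1 - (Real.sinh x : ℂ) * Complex.I)
      = (Real.cosh x : ℂ) ^ 2 := by
  have h : (Real.cosh x : ℂ) ^ 2 = (Real.sinh x : ℂ) ^ 2 + 1 := by exact_mod_cast Real.cosh_sq x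
  rw [h]
  linear_combination (-(Real.sinh x : ℂ) ^ 2) * Complex.I_sq

lemma ofReal_cosh_ne_zero (x : ℝ) : (Real.cosh x : ℂ) ≠ 0 :=
  Complex.ofReal_ne_zero.2 (Real.cosh_pos x).ne'

lemma one_add_sinh_mul_I_ne_zero (x : ℝ) : 1 + (Real.sinh x : ℂ) * Complex.I ≠ 0 :=
  left_ne_zero_of_mul (one_add_sinh_mul_I_mul x ▸ pow_ne_zero 2 (ofReal_cosh_ne_zero x))

lemma norm_one_add_cosh_div (x : ℝ) :
    ‖(1 + Real.cosh x : ℂ) / (1 + Real.sinh x * Complex.I)‖ = 1 + 1 / Real.cosh x := by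
  have hc := Real.cosh_pos x
  have hden : ‖(1 + Real.sinh x * Complex.I : ℂ)‖ = Real.cosh x := by
    have h := Complex.norm_add_mul_I 1 (Real.sinh x)
    rw [one_pow, add_comm (1 : ℝ), ← Real.cosh_sq, Real.sqrt_sq hc.le, Complex.ofReal_one] at h
    exact h
  have hnum : ‖(1 + Real.cosh x : ℂ)‖ = 1 + Real.cosh x := by
    exact_mod_cast Complex.norm_of_nonneg (by linarith : 0 ≤ 1 + Real.cosh x)
  rw [norm_div, hden, hnum, add_div, div_self hc.ne', add_comm]

/-- The Fourier multiplier of the principal value convolution with `hartleyKernel`. -/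
def multiplier (τ : ℝ) : ℂ :=
  Real.pi / 2 * ((1 + Real.cosh (Real.pi * τ)) / (1 + Real.sinh (Real.pi * τ) * Complex.I))

lemma norm_multiplier_le (τ : ℝ) : ‖multiplier τ‖ ≤ Real.pi := by
  have hπ : ‖(Real.pi / 2 : ℂ)‖ = Real.pi / 2 := by
    rw [norm_div, Complex.norm_real, Real.norm_of_nonneg Real.pi_pos.le, Complex.norm_two]
  have hc : 1 / Real.cosh (Real.pi * τ) ≤ 1 :=
    div_le_one_of_le₀ (Real.one_le_cosh _) (Real.cosh_pos _).le
  rw [multiplier, norm_mul, hπ, norm_one_add_cosh_div]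
  nlinarith only [hc, Real.pi_pos]

lemma multiplier_eq_add (τ : ℝ) :
    multiplier τ = 1 / 2 * (((Real.pi / Real.cosh (Real.pi * τ)) ^ 2 : ℝ) / Real.pi
      - (Real.pi ^ 2 * Real.sinh (Real.pi * τ) / Real.cosh (Real.pi * τ) ^ 2 : ℝ)
          * Complex.I / Real.pi
      + (Real.pi / Real.cosh (Real.pi * τ) : ℝ)
      - (Real.pi * Real.tanh (Real.pi * τ) : ℝ) * Complex.I) := by
  have hπ : (Real.pi : ℂ) ≠ 0 := Complex.ofReal_ne_zero.2 Real.pi_ne_zero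
  have hc := ofReal_cosh_ne_zero (Real.pi * τ)
  rw [multiplier, ← mul_div_assoc, div_eq_iff (one_add_sinh_mul_I_ne_zero _),
    Real.tanh_eq_sinh_div_cosh]
  have hmul := one_add_sinh_mul_I_mul (Real.pi * τ)
  simp only [Complex.ofReal_div, Complex.ofReal_mul, Complex.ofReal_pow]
  field_simp
  linear_combination (-(1 + (Real.cosh (Real.pi * τ) : ℂ))) * hmul

lemma pi_mul_line (τ : ℝ) :
    (Real.pi : ℂ) * line τ = (Real.pi * τ : ℝ) * Complex.I + Real.pi / 2 := by
  simp only [line]; push_cast; ring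

lemma sin_pi_mul_line (τ : ℝ) : Complex.sin (Real.pi * line τ) = Real.cosh (Real.pi * τ) := by
  rw [pi_mul_line, Complex.sin_add_pi_div_two, Complex.cos_mul_I, Complex.ofReal_cosh]

lemma sin_sq_pi_mul_line_div_two (τ : ℝ) : Complex.sin (Real.pi * line τ / 2) ^ 2
    = (1 + Real.sinh (Real.pi * τ) * Complex.I) / 2 := by
  rw [Complex.sin_sq, Complex.cos_sq, mul_div_cancel₀ _ (two_ne_zero' ℂ), pi_mul_line,
    Complex.cos_add_pi_div_two, Complex.sin_mul_I, Complex.ofReal_sinh]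
  ring

lemma symbol_line_eq (τ : ℝ) :
    symbol (line τ) = Real.sqrt (2 * Real.pi)
      * ((1 + Real.cosh (Real.pi * τ)) / (1 + Real.sinh (Real.pi * τ) * Complex.I)) := by
  have hsqrt : Real.sqrt (2 * Real.pi) = 2 * Real.sqrt (Real.pi / 2) := by
    rw [← Real.sqrt_sq zero_le_two, ← Real.sqrt_mul (by positivity)]
    ring_nf
  have hne := one_add_sinh_mul_I_ne_zero (Real.pi * τ)
  rw [symbol, sin_pi_mul_line, sin_sq_pi_mul_line_div_two, hsqrt]
  push_cast at *
  field_simp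

/-- The factor `2^{3/2} / √π` in front of the principal value. -/
def pvConst : ℂ := (((2 : ℝ) ^ ((3 : ℝ) / 2) / Real.sqrt Real.pi : ℝ) : ℂ)

lemma pvConst_mul_multiplier (τ : ℝ) : pvConst * multiplier τ = symbol (line τ) := by
  have hconst : (2 : ℝ) ^ ((3 : ℝ) / 2) / Real.sqrt Real.pi * (Real.pi / 2)
      = Real.sqrt (2 * Real.pi) := by
    have hpow : (2 : ℝ) ^ ((3 : ℝ) / 2) = 2 * Real.sqrt 2 := by
      rw [show (3 : ℝ) / 2 = 1 + 1 / 2 by norm_num, Real.rpow_add two_pos, Real.rpow_one,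
        ← Real.sqrt_eq_rpow]
    rw [hpow, Real.sqrt_mul zero_le_two, div_mul_eq_mul_div, div_eq_iff (by positivity)]
    linear_combination (-Real.sqrt 2) * Real.mul_self_sqrt Real.pi_pos.le
  rw [symbol_line_eq, pvConst, multiplier, ← mul_assoc, ← hconst]
  push_cast
  rfl

lemma norm_symbol_line (τ : ℝ) :
    ‖symbol (line τ)‖ = Real.sqrt (2 * Real.pi) * (1 + 1 / Real.cosh (Real.pi * τ)) := by
  rw [symbol_line_eq, norm_mul, norm_one_add_cosh_div, Complex.norm_real,
    Real.norm_of_nonneg (Real.sqrt_nonneg _)]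

lemma symbol_line_mul_symbol_line_neg (τ : ℝ) :
    symbol (line τ) * symbol (line (-τ))
      = 2 * Real.pi * (1 + 1 / (Real.cosh (Real.pi * τ) : ℂ)) ^ 2 := by
  have hc := ofReal_cosh_ne_zero (Real.pi * τ)
  have hsqrt : (Real.sqrt (2 * Real.pi) : ℂ) * Real.sqrt (2 * Real.pi) = 2 * Real.pi := by
    exact_mod_cast Real.mul_self_sqrt Real.two_pi_pos.le
  rw [symbol_line_eq, symbol_line_eq, mul_mul_mul_comm, hsqrt, mul_neg, Real.cosh_neg,
    Real.sinh_neg, Complex.ofReal_neg, neg_mul, ← sub_eq_add_neg, div_mul_div_comm,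
    one_add_sinh_mul_I_mul]
  field_simp
  ring

/-- The kernel of the integro-functional equation in logarithmic coordinates. -/
def hartleyKernel (v : ℝ) : ℝ :=
  1 / 2 * (logKernel v / Real.pi - v * sechKernel v / Real.pi + sechKernel v - cschKernel v)

lemma isFourierPair_sechKernel : IsFourierPair (fun v => (sechKernel v : ℂ))
    fun ξ => (Real.pi / Real.cosh (Real.pi * freq ξ) : ℝ) :=
  funext fourier_sechKernel ▸ isFourierPair_fourier integrable_sechKernel.ofReal memLp_sechKernel

lemma isFourierPair_logKernel : IsFourierPair (fun v => (logKernel v : ℂ))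
    fun ξ => ((Real.pi / Real.cosh (Real.pi * freq ξ)) ^ 2 : ℝ) :=
  funext fourier_logKernel ▸ isFourierPair_fourier integrable_logKernel.ofReal memLp_logKernel

lemma isFourierPair_mul_sechKernel :
    IsFourierPair (fun v => ((v * sechKernel v : ℝ) : ℂ)) fun ξ =>
      (Real.pi ^ 2 * Real.sinh (Real.pi * freq ξ) / Real.cosh (Real.pi * freq ξ) ^ 2 : ℝ)
        * Complex.I := by
  rw [← funext fourier_mul_sechKernel]
  refine isFourierPair_fourier integrable_mul_sechKernel.ofReal
    (memLp_two_of_integrable_of_norm_le integrable_mul_sechKernel.ofReal (C := 1) fun v => ?_)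
  rw [Complex.norm_real]
  exact (abs_mul_sechKernel_le_logKernel v).trans (logKernel_le_one v)

lemma isFourierPair_hartleyKernel_add_inv :
    IsFourierPair (fun v => ((hartleyKernel v + 1 / 2 * v⁻¹ : ℝ) : ℂ))
      (fun ξ => multiplier (freq ξ) + 1 / 2 * hilbertMultiplier ξ) := by
  have h := (((isFourierPair_logKernel.const_smul (1 / Real.pi)).sub
    (isFourierPair_mul_sechKernel.const_smul (1 / Real.pi))).add isFourierPair_sechKernel).sub
    isFourierPair_cschRemainder
  refine ((h.const_smul (1 / 2)).congr_left (.of_forall fun v => ?_)).congr_right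
    (.of_forall fun ξ => ?_)
  · simp only [hartleyKernel, cschRemainder, Pi.smul_apply, Pi.add_apply, Pi.sub_apply, smul_eq_mul]
    push_cast
    ring
  · simp only [multiplier_eq_add, Pi.smul_apply, Pi.add_apply, Pi.sub_apply, smul_eq_mul]
    ring

lemma memLp_top_multiplier_add_hilbertMultiplier :
    MemLp (fun ξ => multiplier (freq ξ) + 1 / 2 * hilbertMultiplier ξ) ∞ := by
  refine memLp_top_of_bound isFourierPair_hartleyKernel_add_inv.memLp_right.1
    (Real.pi + 1 / 2 * Real.pi) (.of_forall fun ξ => ?_)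
  refine norm_add_le_of_le (norm_multiplier_le _) ?_
  rw [norm_mul, norm_div, norm_one, Complex.norm_two]
  exact mul_le_mul_of_nonneg_left (norm_hilbertMultiplier_le ξ) one_half_pos.le

lemma memLp_indicator_cutSet_inv (h0 : 0 < ε) (h1 : ε ≤ 1 / 2) :
    MemLp (fun v => (((cutSet ε).indicator (·⁻¹) v : ℝ) : ℂ)) 2 := by
  have hd := memLp_two_of_le_poisson h0 zero_le_two
    (measurable_indicator_cutSet_inv_sub_conjPoisson ε).aestronglyMeasurable
    (abs_indicator_cutSet_inv_sub_conjPoisson_le h0 h1)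
  have h := (hd.ofReal (K := ℂ)).add (isFourierPair_conjPoisson h0).memLp_left
  refine h.ae_eq (.of_forall fun v => ?_)
  simp only [Pi.add_apply, Complex.coe_algebraMap, ← Complex.ofReal_add, sub_add_cancel]

lemma ofReal_indicator_cutSet_hartleyKernel (ε v : ℝ) :
    (((cutSet ε).indicator hartleyKernel v : ℝ) : ℂ)
      = (cutSet ε).indicator (fun v => ((hartleyKernel v + 1 / 2 * v⁻¹ : ℝ) : ℂ)) v
        - 1 / 2 * (((cutSet ε).indicator (·⁻¹) v : ℝ) : ℂ) := by
  by_cases hv : v ∈ cutSet ε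
  · simp [indicator_of_mem hv]
  · simp [indicator_of_notMem hv]

lemma memLp_indicator_cutSet_hartleyKernel_add_inv (ε : ℝ) :
    MemLp ((cutSet ε).indicator fun v => ((hartleyKernel v + 1 / 2 * v⁻¹ : ℝ) : ℂ)) 2 :=
  isFourierPair_hartleyKernel_add_inv.memLp_left.indicator (measurableSet_cutSet ε)

lemma memLp_indicator_cutSet_hartleyKernel (h0 : 0 < ε) (h1 : ε ≤ 1 / 2) :
    MemLp (fun v => (((cutSet ε).indicator hartleyKernel v : ℝ) : ℂ)) 2 := by
  simp_rw [ofReal_indicator_cutSet_hartleyKernel]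
  exact (memLp_indicator_cutSet_hartleyKernel_add_inv ε).sub
    ((memLp_indicator_cutSet_inv h0 h1).const_mul (1 / 2))

lemma tendsto_integral_indicator_cutSet_mul {κ : ℝ → ℂ} (hκ : MemLp κ 2) (hm : MemLp m 2)
    (u : ℝ) : Tendsto (fun ε => ∫ w, (cutSet ε).indicator κ (u - w) * m w) (𝓝[>] 0)
      (𝓝 (∫ w, κ (u - w) * m w)) := by
  have hint (κ : ℝ → ℂ) (hκ : MemLp κ 2) : Integrable fun w => κ (u - w) * m w :=
    integrable_smul_comp_sub hκ hm u
  refine tendsto_integral_filter_of_dominated_convergence (fun w => ‖κ (u - w) * m w‖)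
    (.of_forall fun ε => (hint _ (hκ.indicator (measurableSet_cutSet ε))).1)
    (.of_forall fun ε => .of_forall fun w => ?_) (hint κ hκ).norm ?_
  · rw [norm_mul, norm_mul]
    exact mul_le_mul_of_nonneg_right (norm_indicator_le_norm_self _ _) (norm_nonneg _)
  · filter_upwards [volume.ae_ne u] with w hw
    refine tendsto_const_nhds.congr' ?_
    filter_upwards [eventually_mem_cutSet (sub_ne_zero.2 hw.symm)] with ε hε
    rw [indicator_of_mem hε]

theorem exists_isFourierPair_multiplier (hm : IsFourierPair m M) :
    ∃ H, IsFourierPair H (fun ξ => multiplier (freq ξ) * M ξ) ∧ ∀ᵐ u, Tendsto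
      (fun ε => ∫ w, (((cutSet ε).indicator hartleyKernel (u - w) : ℝ) : ℂ) * m w) (𝓝[>] 0)
      (𝓝 (H u)) := by
  obtain ⟨H, hH⟩ := exists_isFourierPair_left (hm.memLp_right.mul memLp_top_hilbertMultiplier)
  have hR := isFourierPair_hartleyKernel_add_inv
  refine ⟨_, ((hR.convolution hm memLp_top_multiplier_add_hilbertMultiplier).sub
    (hH.const_smul (1 / 2))).congr_right (.of_forall fun ξ => ?_), ?_⟩
  · simp only [Pi.smul_apply, Pi.sub_apply, Pi.mul_apply, smul_eq_mul]
    ring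
  · filter_upwards [ae_tendsto_integral_indicator_cutSet_inv_mul hm hH] with u hu
    refine ((tendsto_integral_indicator_cutSet_mul hR.memLp_left hm.memLp_left u).sub
      (hu.const_mul (1 / 2))).congr' ?_
    filter_upwards [eventually_pos_and_le_half] with ε ⟨h0, h1⟩
    rw [← integral_const_mul, ← integral_sub]
    · simp only [ofReal_indicator_cutSet_hartleyKernel, sub_mul, mul_assoc]
    · exact integrable_smul_comp_sub (memLp_indicator_cutSet_hartleyKernel_add_inv ε)
        hm.memLp_left u
    · exact (integrable_smul_comp_sub (memLp_indicator_cutSet_inv h0 h1) hm.memLp_left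
        u).const_mul (1 / 2)

end Multiplier

/-! ### The two equations in logarithmic coordinates -/

lemma sechKernel_sub (u w : ℝ) : sechKernel (u - w)
    = Real.exp (u / 2) * Real.exp (w / 2) / (Real.exp (u / 2) ^ 2 + Real.exp (w / 2) ^ 2) := by
  rw [sechKernel, Real.cosh_eq, sub_div, neg_sub, Real.exp_sub, Real.exp_sub]
  field_simp

lemma cschKernel_sub (u w : ℝ) : cschKernel (u - w)
    = Real.exp (u / 2) * Real.exp (w / 2) / (Real.exp (u / 2) ^ 2 - Real.exp (w / 2) ^ 2) := by
  have hu := (Real.exp_pos (u / 2)).ne'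
  have hw := (Real.exp_pos (w / 2)).ne'
  rw [cschKernel, Real.sinh_eq, mul_div_cancel₀ _ (two_ne_zero' ℝ), sub_div u w, neg_sub,
    Real.exp_sub, Real.exp_sub, div_sub_div _ _ hw hu, one_div_div]
  ring_nf

lemma exp_eq_exp_half_sq (u : ℝ) : Real.exp u = Real.exp (u / 2) ^ 2 := by
  rw [← Real.exp_nat_mul]; ring_nf

lemma exp_mul_inv_exp_add (u w : ℝ) : Real.exp w * (Real.exp u + Real.exp w)⁻¹
    = Real.exp (-(u / 2)) * (sechKernel (u - w) * Real.exp (w / 2)) := by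
  rw [sechKernel_sub, exp_eq_exp_half_sq u, exp_eq_exp_half_sq w, Real.exp_neg]
  field_simp

lemma exp_mul_log_div_exp_sub (u w : ℝ) :
    Real.exp w * (Real.log (Real.exp u / Real.exp w) / (Real.exp u - Real.exp w))
      = Real.exp (-(u / 2)) * (logKernel (u - w) * Real.exp (w / 2)) := by
  rw [logKernel, cschKernel_sub, ← Real.exp_sub, Real.log_exp, exp_eq_exp_half_sq u,
    exp_eq_exp_half_sq w, Real.exp_neg]
  field_simp

lemma hartleyKernel_eq_mul (v : ℝ) :
    hartleyKernel v = 1 / 2 * ((v / Real.pi - 1) * (cschKernel v - sechKernel v)) := by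
  rw [hartleyKernel, logKernel]; ring

lemma cschKernel_sub_sechKernel {u w : ℝ} (h : u ≠ w) :
    cschKernel (u - w) - sechKernel (u - w) = 2 * (Real.exp (u / 2) * Real.exp (w / 2) ^ 3)
      / (Real.exp u ^ 2 - Real.exp w ^ 2) := by
  have hsub : Real.exp (u / 2) ^ 2 - Real.exp (w / 2) ^ 2 ≠ 0 := by
    rwa [← exp_eq_exp_half_sq, ← exp_eq_exp_half_sq, sub_ne_zero, Ne, Real.exp_eq_exp]
  rw [cschKernel_sub, sechKernel_sub, div_sub_div _ _ hsub (by positivity), sq_sub_sq (Real.exp u),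
    exp_eq_exp_half_sq u, exp_eq_exp_half_sq w, mul_comm (Real.exp (u / 2) ^ 2 + _)]
  congr 1
  ring

lemma exp_mul_kernel {u w : ℝ} (h : u ≠ w) : Real.exp w * kernel (Real.exp u) (Real.exp w)
    = Real.exp (-(u / 2)) * (hartleyKernel (u - w) * Real.exp (w / 2)) := by
  rw [hartleyKernel_eq_mul, cschKernel_sub_sechKernel h, kernel, ← Real.exp_sub, Real.log_exp,
    Real.exp_neg]
  simp only [exp_eq_exp_half_sq w, exp_eq_exp_half_sq u]
  field_simp

lemma exp_smul_mul_eq_smul_mul_logPullback {k κ u w : ℝ}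
    (h : Real.exp w * k = Real.exp (-(u / 2)) * (κ * Real.exp (w / 2))) (f : ℝ → ℂ) :
    Real.exp w • ((k : ℂ) * f (Real.exp w))
      = Real.exp (-(u / 2)) • ((κ : ℂ) * logPullback f w) := by
  have h' := congrArg (fun r : ℝ => (r : ℂ) * f (Real.exp w)) h
  simp only [Complex.ofReal_mul] at h'
  rw [logPullback, Complex.real_smul, Complex.real_smul, Complex.real_smul]
  linear_combination h'

lemma exp_smul_div_exp_add (μ : ℝ → ℂ) (u w : ℝ) :
    Real.exp w • (μ (Real.exp w) / ((Real.exp u + Real.exp w : ℝ) : ℂ))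
      = Real.exp (-(u / 2)) • ((sechKernel (u - w) : ℂ) * logPullback μ w) := by
  rw [← exp_smul_mul_eq_smul_mul_logPullback (exp_mul_inv_exp_add u w), Complex.ofReal_inv,
    inv_mul_eq_div]

lemma exp_smul_log_mul_div_exp_sub (μ : ℝ → ℂ) (u w : ℝ) :
    Real.exp w • ((Real.log (Real.exp u / Real.exp w) : ℂ) * μ (Real.exp w) /
        ((Real.exp u - Real.exp w : ℝ) : ℂ))
      = Real.exp (-(u / 2)) • ((logKernel (u - w) : ℂ) * logPullback μ w) := by
  rw [← exp_smul_mul_eq_smul_mul_logPullback (exp_mul_log_div_exp_sub u w), Complex.ofReal_div,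
    div_mul_eq_mul_div]

theorem integralsConverge_of_memLp {μ : ℝ → ℂ} (hμ : MemLp μ 2 halfLine) {x : ℝ} (hx : 0 < x) :
    IntegralsConverge μ x := by
  have hm := memLp_halfLine_iff.1 hμ
  obtain ⟨u, rfl⟩ : ∃ u, Real.exp u = x := ⟨Real.log x, Real.exp_log hx⟩
  constructor <;> rw [integrableOn_Ioi_iff_exp_smul]
  · simp_rw [exp_smul_div_exp_add]
    exact Integrable.smul (_ : ℝ) (integrable_smul_comp_sub memLp_sechKernel hm u)
  · simp_rw [exp_smul_log_mul_div_exp_sub]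
    exact Integrable.smul (_ : ℝ) (integrable_smul_comp_sub memLp_logKernel hm u)

lemma SolvesIntegralEquation.ae_convolution_eq_zero {lam : ℂ} {μ : ℝ → ℂ}
    (h : SolvesIntegralEquation lam μ) :
    ∀ᵐ u, (2 * (Real.pi : ℂ) - lam ^ 2) * logPullback μ u
      + 4 * (∫ w, (sechKernel (u - w) : ℂ) * logPullback μ w)
      + 2 / (Real.pi : ℂ) * (∫ w, (logKernel (u - w) : ℂ) * logPullback μ w) = 0 := by
  filter_upwards [ae_halfLine_iff.1 h] with u hu
  simp_rw [integral_Ioi_eq_integral_exp_smul, exp_smul_div_exp_add, exp_smul_log_mul_div_exp_sub,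
    integral_smul, ← exp_neg_half_smul_logPullback μ u] at hu
  refine (smul_eq_zero_iff_right (Real.exp_pos (-(u / 2))).ne').1 ?_
  rw [← hu]
  simp only [Complex.real_smul]
  ring

theorem SolvesIntegralEquation.multiplier_mul_eq_zero {lam : ℂ} {μ : ℝ → ℂ} {φ : ℂ → ℂ}
    (h : SolvesIntegralEquation lam μ) (hμ : IsInvMellin φ μ) :
    ∀ᵐ τ : ℝ, (symbol (line τ) * symbol (line (-τ)) - lam ^ 2) * φ (line τ) = 0 := by
  have hm := isInvMellin_iff_isFourierPair.1 hμ
  have hsech := isFourierPair_sechKernel.convolution hm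
    (funext fourier_sechKernel ▸ memLp_top_fourier integrable_sechKernel.ofReal)
  have hlog := isFourierPair_logKernel.convolution hm
    (funext fourier_logKernel ▸ memLp_top_fourier integrable_logKernel.ofReal)
  have hsum := ((hm.const_smul (2 * (Real.pi : ℂ) - lam ^ 2)).add (hsech.const_smul 4)).add
    (hlog.const_smul (2 / (Real.pi : ℂ)))
  have hzero : IsFourierPair (0 : ℝ → ℂ) 0 := by simpa using hm.sub hm
  rw [← ae_freq_iff]
  filter_upwards [(hsum.congr_left h.ae_convolution_eq_zero).unique_right hzero] with ξ hξ
  simp only [Pi.add_apply, Pi.smul_apply, smul_eq_mul, Pi.zero_apply] at hξ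
  rw [symbol_line_mul_symbol_line_neg, ← hξ]
  push_cast
  field_simp
  ring

lemma mem_cutSet_iff {ε : ℝ} (h0 : 0 < 1 + ε) (h1 : 0 < 1 - ε) (u w : ℝ) :
    u - w ∈ cutSet ε ↔ ε * Real.exp u < |Real.exp w - Real.exp u| := by
  have hfactor : Real.exp w - Real.exp u = (Real.exp (w - u) - 1) * Real.exp u := by
    rw [sub_mul, ← Real.exp_add, sub_add_cancel, one_mul]
  have hleft : -Real.log (1 - ε) < u - w ↔ ε < 1 - Real.exp (w - u) := by
    rw [lt_sub_comm (a := ε), ← Real.lt_log_iff_exp_lt h1, neg_lt, neg_sub]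
  have hright : u - w < -Real.log (1 + ε) ↔ ε < Real.exp (w - u) - 1 := by
    rw [lt_sub_iff_add_lt', ← Real.log_lt_iff_lt_exp h0, lt_neg, neg_sub]
  rw [hfactor, abs_mul, abs_of_pos (Real.exp_pos u), mul_lt_mul_iff_left₀ (Real.exp_pos u), lt_abs,
    cutSet, mem_union, mem_Ioi, mem_Iio, hleft, hright, neg_sub, or_comm]

section PrincipalValue

variable {f : ℝ → ℂ} {ε : ℝ}

lemma exp_smul_indicator_kernel_mul (f : ℝ → ℂ) (h0 : 0 < ε) (h1 : ε ≤ 1 / 2) (u w : ℝ) :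
    Real.exp w • {t : ℝ | ε * Real.exp u < |t - Real.exp u|}.indicator
        (fun t => (kernel (Real.exp u) t : ℂ) * f t) (Real.exp w)
      = Real.exp (-(u / 2))
        • ((((cutSet ε).indicator hartleyKernel (u - w) : ℝ) : ℂ) * logPullback f w) := by
  have hmem : u - w ∈ cutSet ε ↔ Real.exp w ∈ {t : ℝ | ε * Real.exp u < |t - Real.exp u|} :=
    mem_cutSet_iff (by linarith) (by linarith) u w
  by_cases hw : u - w ∈ cutSet ε
  · have hne : u ≠ w := by
      rintro rfl
      linarith [half_le_abs_of_mem_cutSet h0 h1 hw, abs_eq_zero.2 (sub_self u)]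
    rw [indicator_of_mem (hmem.1 hw), indicator_of_mem hw,
      exp_smul_mul_eq_smul_mul_logPullback (exp_mul_kernel hne)]
  · rw [indicator_of_notMem (mt hmem.2 hw), indicator_of_notMem hw, smul_zero, Complex.ofReal_zero,
      zero_mul, smul_zero]

lemma measurableSet_lt_abs_sub (a x : ℝ) : MeasurableSet {t : ℝ | a < |t - x|} :=
  measurableSet_lt measurable_const (by fun_prop)

lemma setIntegral_kernel_mul (f : ℝ → ℂ) (h0 : 0 < ε) (h1 : ε ≤ 1 / 2) (u : ℝ) :
    ∫ t in {t : ℝ | 0 < t ∧ ε * Real.exp u < |t - Real.exp u|}, (kernel (Real.exp u) t : ℂ) * f t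
      = Real.exp (-(u / 2))
        • ∫ w, (((cutSet ε).indicator hartleyKernel (u - w) : ℝ) : ℂ) * logPullback f w := by
  change ∫ t in Ioi 0 ∩ {t : ℝ | ε * Real.exp u < |t - Real.exp u|}, _ = _
  rw [← setIntegral_indicator (measurableSet_lt_abs_sub _ _), integral_Ioi_eq_integral_exp_smul,
    ← integral_smul]
  simp_rw [exp_smul_indicator_kernel_mul f h0 h1]

lemma integrableOn_kernel_mul_of_le_half (hf : MemLp (logPullback f) 2) (h0 : 0 < ε)
    (h1 : ε ≤ 1 / 2) (u : ℝ) :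
    IntegrableOn (fun t => (kernel (Real.exp u) t : ℂ) * f t)
      {t : ℝ | 0 < t ∧ ε * Real.exp u < |t - Real.exp u|} := by
  change IntegrableOn _ (Ioi 0 ∩ {t : ℝ | ε * Real.exp u < |t - Real.exp u|})
  have hs := measurableSet_lt_abs_sub (ε * Real.exp u) (Real.exp u)
  rw [inter_comm, IntegrableOn, ← Measure.restrict_restrict hs]
  refine (integrable_indicator_iff hs).1 ((integrableOn_Ioi_iff_exp_smul _).2 ?_)
  simp_rw [exp_smul_indicator_kernel_mul f h0 h1]
  exact Integrable.smul (_ : ℝ)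
    (integrable_smul_comp_sub (memLp_indicator_cutSet_hartleyKernel h0 h1) hf u)

lemma integrableOn_kernel_mul (hf : MemLp (logPullback f) 2) (h0 : 0 < ε) (u : ℝ) :
    IntegrableOn (fun t => (kernel (Real.exp u) t : ℂ) * f t)
      {t : ℝ | 0 < t ∧ ε < |t - Real.exp u|} := by
  have hu := Real.exp_pos u
  have hδ : 0 < min (ε / Real.exp u) (1 / 2) := lt_min (div_pos h0 hu) one_half_pos
  refine (integrableOn_kernel_mul_of_le_half hf hδ (min_le_right _ _) u).mono_set fun t ht =>
    ⟨ht.1, lt_of_le_of_lt ?_ ht.2⟩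
  rw [← le_div_iff₀ hu]
  exact min_le_left _ _

lemma tendsto_nhdsGT_zero_comp_mul_const_iff {E : Type*} {F : ℝ → E} {l : Filter E} {c : ℝ}
    (hc : 0 < c) : Tendsto (fun ε => F (ε * c)) (𝓝[>] 0) l ↔ Tendsto F (𝓝[>] 0) l := by
  have h : map (c * ·) (𝓝[>] 0) = 𝓝[>] 0 := by
    conv_lhs => rw [← comap_mulLeft_nhdsGT_zero hc]
    exact map_comap_of_surjective (mul_left_surjective₀ hc.ne') _
  simp_rw [mul_comm _ c]
  conv_rhs => rw [← h, tendsto_map'_iff]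
  rfl

theorem hasPV_kernel_mul_iff (hf : MemLp (logPullback f) 2) (u : ℝ) (v : ℂ) :
    HasPV (fun t => (kernel (Real.exp u) t : ℂ) * f t) (Real.exp u) v ↔
      Tendsto (fun ε => ∫ w, (((cutSet ε).indicator hartleyKernel (u - w) : ℝ) : ℂ)
        * logPullback f w) (𝓝[>] 0) (𝓝 (Real.exp (u / 2) • v)) := by
  have hint (ε : ℝ) (hε : 0 < ε) := integrableOn_kernel_mul hf hε u
  rw [HasPV, and_iff_right hint, ← tendsto_nhdsGT_zero_comp_mul_const_iff (Real.exp_pos u)]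
  rw [← tendsto_const_smul_iff₀ (Real.exp_pos (u / 2)).ne']
  refine tendsto_congr' ?_
  filter_upwards [eventually_pos_and_le_half] with ε ⟨h0, h1⟩
  rw [setIntegral_kernel_mul f h0 h1, smul_smul, ← Real.exp_add, add_neg_cancel, Real.exp_zero,
    one_smul]

theorem ae_hasPV_kernel_mul_iff_isFourierPair {V G : ℝ → ℂ} (hf : IsFourierPair (logPullback f) G) :
    (∀ᵐ x ∂halfLine, HasPV (fun t => (kernel x t : ℂ) * f t) x (V x)) ↔
      IsFourierPair (logPullback V) (fun ξ => multiplier (freq ξ) * G ξ) := by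
  obtain ⟨W, hW, hlim⟩ := exists_isFourierPair_multiplier hf
  simp_rw [ae_halfLine_iff, hasPV_kernel_mul_iff hf.memLp_left]
  constructor
  · intro h
    refine hW.congr_left ?_
    filter_upwards [h, hlim] with u hV hW using tendsto_nhds_unique hW hV
  · intro h
    filter_upwards [hlim, hW.unique_left h] with u hu hWV
    rw [hWV] at hu
    exact hu

end PrincipalValue

lemma logPullback_comp_inv (c : ℂ) (f : ℝ → ℂ) :
    logPullback (fun x => c / (x : ℂ) * f (1 / x)) = c • fun u => logPullback f (-u) := by
  ext u
  have hexp : Real.exp (u / 2) / Real.exp u = Real.exp (-u / 2) := by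
    rw [← Real.exp_sub]; ring_nf
  simp only [logPullback, Pi.smul_apply, smul_eq_mul, Complex.real_smul, one_div, ← Real.exp_neg,
    ← hexp, Complex.ofReal_div]
  ring

lemma pvConst_ne_zero : pvConst ≠ 0 :=
  Complex.ofReal_ne_zero.2
    (div_pos (Real.rpow_pos_of_pos two_pos _) (Real.sqrt_pos.2 Real.pi_pos)).ne'

lemma solvesIntegroFunctional_iff_ae_hasPV {lam : ℂ} {f : ℝ → ℂ} :
    SolvesIntegroFunctional lam f ↔ ∀ᵐ x ∂halfLine, HasPV (fun t => (kernel x t : ℂ) * f t) x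
      (pvConst⁻¹ * lam / (x : ℂ) * f (1 / x)) := by
  refine eventually_congr (.of_forall fun x => ?_)
  have hv (v : ℂ) : pvConst * v = lam / (x : ℂ) * f (1 / x) ↔
      v = pvConst⁻¹ * lam / (x : ℂ) * f (1 / x) := by
    rw [← eq_inv_mul_iff_mul_eq₀ pvConst_ne_zero, mul_div_assoc, mul_assoc]
  change (∃ v, _ ∧ pvConst * v = _) ↔ _
  simp only [hv, exists_eq_right]

theorem IsInvMellin.solvesIntegroFunctional_iff {lam : ℂ} {F : ℂ → ℂ} {f : ℝ → ℂ}
    (hf : IsInvMellin F f) : SolvesIntegroFunctional lam f ↔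
      ∀ᵐ τ : ℝ, symbol (line τ) * F (line τ) = lam * F (1 - line τ) := by
  have hpair := isInvMellin_iff_isFourierPair.1 hf
  have hinv := hpair.comp_neg.const_smul (pvConst⁻¹ * lam)
  have hsymb (ξ : ℝ) : symbol (line (freq ξ)) * F (line (freq ξ)) = lam * F (1 - line (freq ξ)) ↔
      multiplier (freq ξ) * F (line (freq ξ)) = pvConst⁻¹ * lam * F (line (freq (-ξ))) := by
    rw [← pvConst_mul_multiplier, mul_assoc, mul_assoc, eq_inv_mul_iff_mul_eq₀ pvConst_ne_zero,
      one_sub_line, freq_neg]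
  rw [solvesIntegroFunctional_iff_ae_hasPV, ae_hasPV_kernel_mul_iff_isFourierPair hpair,
    logPullback_comp_inv, ← ae_freq_iff]
  simp_rw [hsymb]
  exact ⟨fun h => h.unique_right hinv, fun h => hinv.congr_right (EventuallyEq.symm h)⟩

lemma exists_isInvMellin_of_memLp {f : ℝ → ℂ} (hf : MemLp f 2 halfLine) :
    ∃ F, IsInvMellin F f := by
  obtain ⟨G, hG⟩ := exists_isFourierPair (memLp_halfLine_iff.1 hf)
  refine ⟨fun s => G (s.im / -(2 * Real.pi)),
    isInvMellin_iff_isFourierPair.2 (hG.congr_right (.of_forall fun ξ => ?_))⟩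
  simp [line, freq, Real.pi_ne_zero]

lemma MemL2Line.exists_isInvMellin {F : ℂ → ℂ} (hF : MemL2Line F) : ∃ f, IsInvMellin F f := by
  obtain ⟨g, hg⟩ := exists_isFourierPair_left (memLp_comp_freq_iff.2 hF)
  refine ⟨fun x => Real.exp (-(Real.log x / 2)) • g (Real.log x),
    isInvMellin_iff_isFourierPair.2 (hg.congr_left (.of_forall fun u => ?_))⟩
  rw [logPullback, Real.log_exp, smul_smul, ← Real.exp_add, add_neg_cancel, Real.exp_zero,
    one_smul]

lemma IsInvMellin.congr {F G : ℂ → ℂ} {f : ℝ → ℂ} (hf : IsInvMellin F f)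
    (h : ∀ᵐ τ : ℝ, F (line τ) = G (line τ)) : IsInvMellin G f :=
  isInvMellin_iff_isFourierPair.2
    ((isInvMellin_iff_isFourierPair.1 hf).congr_right (ae_freq_iff.2 h))

lemma MemL2Line.comp_one_sub {F : ℂ → ℂ} (hF : MemL2Line F) : MemL2Line fun s => F (1 - s) := by
  simpa only [MemL2Line, one_sub_line] using!
    hF.comp_measurePreserving (Measure.measurePreserving_neg volume)

lemma continuous_symbol_line : Continuous fun τ => symbol (line τ) := by
  simp_rw [symbol_line_eq]
  refine continuous_const.mul (Continuous.div ?_ ?_ fun τ => one_add_sinh_mul_I_ne_zero _)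
  · exact continuous_const.add (Complex.continuous_ofReal.comp (by fun_prop))
  · exact continuous_const.add
      ((Complex.continuous_ofReal.comp (by fun_prop)).mul continuous_const)

lemma sqrt_two_pi_le_norm_symbol_line (τ : ℝ) :
    Real.sqrt (2 * Real.pi) ≤ ‖symbol (line τ)‖ := by
  rw [norm_symbol_line]
  exact le_mul_of_one_le_right (Real.sqrt_nonneg _)
    (le_add_of_nonneg_right (one_div_nonneg.2 (Real.cosh_pos _).le))

lemma neg_notMem_closure_range_symbol_line {lam : ℂ} (hlam : ‖lam‖ < Real.sqrt (2 * Real.pi)) :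
    -lam ∉ closure (range fun τ => symbol (line τ)) := by
  have hclosed : IsClosed {z : ℂ | Real.sqrt (2 * Real.pi) ≤ ‖z‖} :=
    isClosed_le continuous_const continuous_norm
  have hsub : range (fun τ => symbol (line τ)) ⊆ {z : ℂ | Real.sqrt (2 * Real.pi) ≤ ‖z‖} :=
    range_subset_iff.2 sqrt_two_pi_le_norm_symbol_line
  intro h
  have hle : Real.sqrt (2 * Real.pi) ≤ ‖-lam‖ := closure_minimal hsub hclosed h
  rw [norm_neg] at hle
  exact hlam.not_ge hle

section Spectrum

variable {lam : ℂ} (hlam : -lam ∉ closure (range fun τ => symbol (line τ)))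
include hlam

lemma symbol_line_add_ne_zero (τ : ℝ) : symbol (line τ) + lam ≠ 0 := fun h =>
  hlam (subset_closure ⟨τ, eq_neg_of_add_eq_zero_left h⟩)

lemma MemL2Line.inv_symbol_add_mul {φ : ℂ → ℂ} (hφ : MemL2Line φ) :
    MemL2Line fun s => (symbol s + lam)⁻¹ * φ s := by
  obtain ⟨δ, hδ, hdist⟩ : ∃ δ > 0, ∀ τ, δ ≤ dist (-lam) (symbol (line τ)) := by
    simpa [Metric.mem_closure_iff] using hlam
  refine MemLp.of_le_mul (c := δ⁻¹) hφ
    (((continuous_symbol_line.add continuous_const).inv₀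
      (symbol_line_add_ne_zero hlam)).aestronglyMeasurable.mul hφ.1) (.of_forall fun τ => ?_)
  rw [norm_mul, norm_inv]
  refine mul_le_mul_of_nonneg_right (inv_anti₀ hδ ?_) (norm_nonneg _)
  rw [← sub_neg_eq_add, ← dist_eq_norm, dist_comm]
  exact hdist τ

theorem SolvesIntegroFunctional.exists_isInvMellin {f : ℝ → ℂ} (hf : MemLp f 2 halfLine)
    (hsol : SolvesIntegroFunctional lam f) :
    ∃ φ : ℂ → ℂ, MemL2Line φ ∧ (∀ s : ℂ, φ s = φ (1 - s)) ∧
      IsInvMellin (fun s => (symbol s + lam)⁻¹ * φ s) f := by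
  obtain ⟨F, hF⟩ := exists_isInvMellin_of_memLp hf
  refine ⟨fun s => lam * (F s + F (1 - s)),
    (hF.memL2Line.add hF.memL2Line.comp_one_sub).const_mul lam, fun s => ?_, hF.congr ?_⟩
  · simp only [sub_sub_cancel, add_comm]
  · filter_upwards [hF.solvesIntegroFunctional_iff.1 hsol] with τ hτ
    rw [eq_inv_mul_iff_mul_eq₀ (symbol_line_add_ne_zero hlam τ), add_mul, hτ]
    ring

theorem SolvesIntegralEquation.solvesIntegroFunctional {φ : ℂ → ℂ} {μ f : ℝ → ℂ}
    (hsymm : ∀ᵐ τ : ℝ, φ (line τ) = φ (1 - line τ)) (hμ : IsInvMellin φ μ)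
    (hsol : SolvesIntegralEquation lam μ)
    (hf : IsInvMellin (fun s => (symbol s + lam)⁻¹ * φ s) f) :
    SolvesIntegroFunctional lam f := by
  refine hf.solvesIntegroFunctional_iff.2 ?_
  filter_upwards [hsymm, hsol.multiplier_mul_eq_zero hμ] with τ hs hz
  have hne := symbol_line_add_ne_zero hlam τ
  have hne' := symbol_line_add_ne_zero hlam (-τ)
  rw [← hs, one_sub_line]
  field_simp
  linear_combination hz

end Spectrum

end HartleyFourier

end

open HartleyFourier in
theorem theorem11_general (lam : ℂ) (hlam : -lam ∉ closure (range fun τ => symbol (line τ))) :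
    (∀ f : ℝ → ℂ, MemLp f 2 halfLine → SolvesIntegroFunctional lam f →
      ∃ φ : ℂ → ℂ, MemL2Line φ ∧ (∀ s : ℂ, s.re = 1 / 2 → φ s = φ (1 - s)) ∧
        IsInvMellin (fun s => (symbol s + lam)⁻¹ * φ s) f) ∧
    (∀ (φ : ℂ → ℂ) (μ : ℝ → ℂ), (∀ᵐ τ : ℝ, φ (line τ) = φ (1 - line τ)) → IsInvMellin φ μ →
      (∀ x : ℝ, 0 < x → IntegralsConverge μ x) ∧
      (SolvesIntegralEquation lam μ →
        (∃ f : ℝ → ℂ, IsInvMellin (fun s => (symbol s + lam)⁻¹ * φ s) f) ∧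
        ∀ f : ℝ → ℂ, IsInvMellin (fun s => (symbol s + lam)⁻¹ * φ s) f →
          SolvesIntegroFunctional lam f)) := by
  constructor
  · intro f hf hsol
    obtain ⟨φ, hφ, hsymm, hinv⟩ := hsol.exists_isInvMellin hlam hf
    exact ⟨φ, hφ, fun s _ => hsymm s, hinv⟩
  · intro φ μ hsymm hμ
    exact ⟨fun x hx => integralsConverge_of_memLp hμ.memLp hx, fun hsol =>
      ⟨(hμ.memL2Line.inv_symbol_add_mul hlam).exists_isInvMellin, fun f hf =>
        hsol.solvesIntegroFunctional hlam hsymm hμ hf⟩⟩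

theorem theorem11 (lam : ℂ) (hlam : ‖lam‖ < Real.sqrt (2 * Real.pi)) :
    -- necessity
    (∀ f : ℝ → ℂ, MemLp f 2 HartleyFourier.halfLine →
      HartleyFourier.SolvesIntegroFunctional lam f →
      ∃ φ : ℂ → ℂ, HartleyFourier.MemL2Line φ ∧
        (∀ s : ℂ, s.re = 1 / 2 → φ s = φ (1 - s)) ∧
        HartleyFourier.IsInvMellin (fun s => (HartleyFourier.symbol s + lam)⁻¹ * φ s) f) ∧
    -- sufficiency
    (∀ (φ : ℂ → ℂ) (μ : ℝ → ℂ), HartleyFourier.MemL2Line φ →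
      (∀ᵐ τ : ℝ, φ (HartleyFourier.line τ) = φ (1 - HartleyFourier.line τ)) →
      HartleyFourier.IsInvMellin φ μ →
      (∀ x : ℝ, 0 < x → HartleyFourier.IntegralsConverge μ x) ∧
      (HartleyFourier.SolvesIntegralEquation lam μ →
        (∃ f : ℝ → ℂ,
          HartleyFourier.IsInvMellin (fun s => (HartleyFourier.symbol s + lam)⁻¹ * φ s) f) ∧
        ∀ f : ℝ → ℂ,
          HartleyFourier.IsInvMellin (fun s => (HartleyFourier.symbol s + lam)⁻¹ * φ s) f →
          HartleyFourier.SolvesIntegroFunctional lam f)) := by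
  have h := theorem11_general lam (HartleyFourier.neg_notMem_closure_range_symbol_line hlam)
  exact ⟨h.1, fun φ μ _ => h.2 φ μ⟩
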